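/- Conventions. A flow $(S_t)_{t\in\mathbb R}$ on a probability space $(X,\mathcal B,\mu)$ is a jointly measurable action of $\mathbb R$ on $X$ by $\mu$-preserving maps. It is weakly mixing if $\frac1T\int_0^T|\mu(S_tA\cap B)-\mu(A)\mu(B)|\,dt\to0$ as $T\to\infty$ for all $A,B\in\mathcal B$. A factor map from $(S_t)$ to a flow $(S'_t)$ on a standard Borel probability space $(X',\mathcal B',\mu')$ is a measurable map $\psi:X\to X'$ with $\psi_*\mu=\mu'$ and, for every $t$, $\psi\circ S_t=S'_t\circ\psi$ $\mu$-a.e.; $(S'_t)$ is then a factor of $(S_t)$, non-trivial if some $A\in\mathcal B'$ has $0<\mu'(A)<1$. The extension is finite if $\psi$ is finite-to-one almost everywhere, i.e. there is a measurable set $E$ of full $\mu$-measure such that $E\cap\psi^{-1}(x')$ is finite for every $x'\in X'$. Let $(X,d)$ be a $\sigma$-compact metric space with Borel $\sigma$-algebra $\mathcal B$, and let $\mu$ be a Borel probability measure on $X$. For a set $P\subset\mathbb R\setminus\{0\}$ and $t_0\neq0$, a flow $(S_t)$ on $(X,\mathcal B,\mu)$ has the property $R(t_0,P)$ if for every $\varepsilon>0$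 there is $\kappa>0$ such that for every $N\in\mathbb N$ there are $\delta>0$ and $Z\in\mathcal B$ with $\mu(Z)>1-\varepsilon$ such that the following holds: whenever $x,x'\in Z$, $x'$ is not in the orbit of $x$, and $d(x,x')<\delta$, there are natural numbers $M,L\ge N$ with $L/M\ge\kappa$ and $p\in P$ with $$\frac1L\,\#\{n\in\mathbb Z\cap[M,M+L]: d(S_{nt_0}x,S_{nt_0+p}x')<\varepsilon\}>1-\varepsilon .$$ It has the weak Ratner property $R(P)$ if the set of $s$ for which it has $R(s,P)$ is uncountable. **Theorem 5.9.** Let $(S_t)$ be a weakly mixing flow on $(X,\mathcal B,\mu)$ having the property $R(P)$ for some non-empty compact set $P\subset\mathbb R\setminus\{0\}$. Assume the almost-continuity condition: for every $\varepsilon>0$ there is $X(\varepsilon)\in\mathcal B$ with $\mu(X(\varepsilon))>1-\varepsilon$ such that for every $\varepsilon'>0$ there is $\varepsilon_1>0$ with $d(S_tx,S_{t'}x)<\varepsilon'$ for all $x\in X(\varepsilon)$ and $t,t'\in[-\varepsilon_1,\varepsilon_1]$. 1. Let $(T_t)$ be an ergodic flow on a standard Borel probability space $(Y,\mathcal C,\nu)$,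 and let $\rho$ be an ergodic joining of $(S_t)$ and $(T_t)$, that is, a measure on $(X\times Y,\mathcal B\otimes\mathcal C)$ with marginals $\mu$ and $\nu$, invariant and ergodic under $(S_t\times T_t)$. Then either $\rho=\mu\otimes\nu$, or $\rho$ is a finite extension of $\nu$: the flow $(S_t\times T_t)$ on $(X\times Y,\rho)$ is a finite extension of $(T_t)$ through the projection $X\times Y\to Y$. 2. In particular, $(S_t)$ is a finite extension of each of its non-trivial factors: every factor map from $(S_t)$ to a non-trivial factor is finite-to-one almost everywhere. -/

import Mathlib

open MeasureTheory Set Filter Topology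

/-!  A measure-preserving flow `(S_t)` on a probability space `(X, μ)` is given by Mathlib's classes
`[AddAction ℝ X] [MeasurableVAdd₂ ℝ X] [VAddInvariantMeasure ℝ X μ]`: `S_t x = t +ᵥ x`, the map
`(t, x) ↦ S_t x` is jointly measurable and every `S_t` preserves `μ`. It is ergodic if
`ErgodicVAdd ℝ X μ`, and the orbit of `x` is `AddAction.orbit ℝ x`. The product flow
`S_t × T_t` is the product action `t +ᵥ (x, y) = (t +ᵥ x, t +ᵥ y)` on `X × Y`. -/

namespace RatnerFlow

/-- Weak mixing: `(1/T) ∫_0^T |μ(S_t A ∩ B) - μ(A) μ(B)| dt → 0` for all measurable `A`, `B`. -/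
def WeaklyMixing {X : Type*} [MeasurableSpace X] [AddAction ℝ X] (μ : Measure X) : Prop :=
  ∀ A B : Set X, MeasurableSet A → MeasurableSet B →
    Tendsto (fun T : ℝ => (1 / T) * ∫ t in (0 : ℝ)..T,
      |μ.real (((fun x : X => t +ᵥ x) '' A) ∩ B) - μ.real A * μ.real B|) atTop (𝓝 0)

/-- The property `R(t₀, P)`. The constant `κ` depends on `ε` only, while `δ` and `Z` depend on `ε`
and `N`. -/
def RatnerAt {X : Type*} [MetricSpace X] [MeasurableSpace X] [AddAction ℝ X] (μ : Measure X)
    (t₀ : ℝ) (P : Set ℝ) : Prop :=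
  t₀ ≠ 0 ∧ ∀ ε : ℝ, 0 < ε → ∃ κ : ℝ, 0 < κ ∧ ∀ N : ℕ, ∃ δ : ℝ, 0 < δ ∧
    ∃ Z : Set X, MeasurableSet Z ∧ 1 - ε < μ.real Z ∧
      ∀ x ∈ Z, ∀ x' ∈ Z, x' ∉ AddAction.orbit ℝ x → dist x x' < δ →
        ∃ M L : ℕ, N ≤ M ∧ N ≤ L ∧ κ ≤ (L : ℝ) / (M : ℝ) ∧ ∃ p ∈ P,
          1 - ε < (({n : ℕ | M ≤ n ∧ n ≤ M + L ∧
            dist (((n : ℝ) * t₀) +ᵥ x) (((n : ℝ) * t₀ + p) +ᵥ x') < ε}.ncard : ℕ) : ℝ) / (L : ℝ)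

/-- The property `R(P)` (weak Ratner property with displacement set `P`): `R(s, P)` holds for
uncountably many `s`. -/
def WeakRatner {X : Type*} [MetricSpace X] [MeasurableSpace X] [AddAction ℝ X] (μ : Measure X)
    (P : Set ℝ) : Prop :=
  ¬ {s : ℝ | RatnerAt μ s P}.Countable

/-- The almost-continuity condition for the flow and the metric. -/
def AlmostContinuous {X : Type*} [MetricSpace X] [MeasurableSpace X] [AddAction ℝ X]
    (μ : Measure X) : Prop :=
  ∀ ε : ℝ, 0 < ε → ∃ E : Set X, MeasurableSet E ∧ 1 - ε < μ.real E ∧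
    ∀ ε' : ℝ, 0 < ε' → ∃ ε₁ : ℝ, 0 < ε₁ ∧
      ∀ x ∈ E, ∀ t ∈ Icc (-ε₁) ε₁, ∀ t' ∈ Icc (-ε₁) ε₁, dist (t +ᵥ x) (t' +ᵥ x) < ε'

/-- Ergodic joinings: measures on `X × Y` with marginals `μ` and `ν` which are invariant and
ergodic for the product flow (`ErgodicVAdd` contains invariance). -/
structure IsErgodicJoining {X Y : Type*} [MeasurableSpace X] [MeasurableSpace Y] [AddAction ℝ X]
    [AddAction ℝ Y] (μ : Measure X) (ν : Measure Y) (ρ : Measure (X × Y)) : Prop where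
  map_fst : ρ.map Prod.fst = μ
  map_snd : ρ.map Prod.snd = ν
  ergodic : ErgodicVAdd ℝ (X × Y) ρ

/-- `ψ` is a factor map from the flow on `(X, μ)` onto the flow on `(Y, ν)`: it is measurable, it
sends `μ` to `ν`, and `ψ ∘ S_t = S'_t ∘ ψ` `μ`-almost everywhere, for every `t`. -/
structure IsFactorMap {X Y : Type*} [MeasurableSpace X] [MeasurableSpace Y] [AddAction ℝ X]
    [AddAction ℝ Y] (ψ : X → Y) (μ : Measure X) (ν : Measure Y) : Prop where
  measurePreserving : MeasurePreserving ψ μ ν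
  equivariant : ∀ t : ℝ, ∀ᵐ x ∂μ, ψ (t +ᵥ x) = t +ᵥ ψ x

/-- `ψ` is finite-to-one almost everywhere: finite-to-one on a measurable set of full measure. -/
def FiniteToOneAE {X Y : Type*} [MeasurableSpace X] (ψ : X → Y) (μ : Measure X) : Prop :=
  ∃ E : Set X, MeasurableSet E ∧ μ Eᶜ = 0 ∧ ∀ y : Y, (E ∩ ψ ⁻¹' {y}).Finite

/-- Through `ψ`, the flow on `(X, μ)` is a finite extension of the flow on `(Y, ν)`. -/
def IsFiniteExtension {X Y : Type*} [MeasurableSpace X] [MeasurableSpace Y] [AddAction ℝ X]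
    [AddAction ℝ Y] (ψ : X → Y) (μ : Measure X) (ν : Measure Y) : Prop :=
  IsFactorMap ψ μ ν ∧ FiniteToOneAE ψ μ

/-- A probability space is non-trivial if it has a measurable set of measure strictly between
`0` and `1`. -/
def Nontriv {X : Type*} [MeasurableSpace X] (μ : Measure X) : Prop :=
  ∃ A : Set X, MeasurableSet A ∧ 0 < μ A ∧ μ A < 1

end RatnerFlow

/-! Let ρ be a joining other than the product. Weak mixing makes every time-q map with q ≠ 0 ergodic
(`ergodic_of_weaklyMixing`), and a joining invariant under S_q × id for an ergodic S_q is the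
product (`eq_prod_of_map_eq`). So no such S_q × id preserves ρ, and some f(x)1_B(y) and f(S_q
x)1_B(y) have different ρ-integrals.

Take distinct, close points x, x' in one fibre over y. The Ratner property gives a window [M, M +
L], with L ≥ κM, during most of which S_{nt₀}x is close to S_{nt₀+p}x' for some p in P. As the
Y-coordinate is shared, the average of f(x)1_B(y) along (x, y) is close to that of f(S_p x)1_B(y)
along (x', y). If both points are generic, these averages are close to two different integrals, a
contradiction (`exists_separating`). Since P is compact and avoids 0, finitely many test functions
suffice; since κ does not depend on N, the ergodic theorem is uniform over all these windows
(`exists_uniform_window`). Hence on a set of positive measure distinct points of a fibre are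
δ-separated (`exists_separated_set`), so its fibres are countable.

The averages run over multiples of t₀, so the time-t₀ map must be ergodic for ρ. Only countably many
nonzero times fail this (`countable_not_ergodic`), while the Ratner property holds at uncountably
many.

Finally, the mass of a point in the conditional measure of its fibre is a flow-invariant function,
hence a constant c. Countable fibres over a set of positive measure force c > 0, so almost every
point lies among at most 1/c points of its fibre (`finiteToOneAE_of_countable_fibres`). A factor map
is handled through its graph joining. -/

namespace RatnerFlow

/-! ### The pointwise ergodic theorem and its uniform version on windows. -/

section Birkhoff

variable {Z : Type*} {R : Z → Z}

/-- The maximum of the Birkhoff sums `S_0 f, …, S_n f`. -/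
def maxBirkhoffSum (R : Z → Z) (f : Z → ℝ) : ℕ → Z → ℝ
  | 0, _ => 0
  | n + 1, z => max 0 (f z + maxBirkhoffSum R f n (R z))

lemma maxBirkhoffSum_nonneg (f : Z → ℝ) (n : ℕ) (z : Z) : 0 ≤ maxBirkhoffSum R f n z := by
  cases n with
  | zero => exact le_rfl
  | succ n => exact le_max_left _ _

lemma birkhoffSum_le_maxBirkhoffSum (f : Z → ℝ) (n : ℕ) (z : Z) :
    birkhoffSum R f n z ≤ maxBirkhoffSum R f n z := by
  induction n generalizing z with
  | zero => simp [maxBirkhoffSum]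
  | succ n ih =>
    rw [birkhoffSum_succ']
    exact le_max_of_le_right (by linarith [ih (R z)])

lemma maxBirkhoffSum_mono (f : Z → ℝ) (z : Z) : Monotone fun n => maxBirkhoffSum R f n z := by
  refine monotone_nat_of_le_succ fun n => ?_
  induction n generalizing z with
  | zero => exact maxBirkhoffSum_nonneg _ _ _
  | succ n ih => exact max_le_max le_rfl (by linarith [ih (R z)])

lemma maxBirkhoffSum_le {f : Z → ℝ} {C : ℝ} (hC0 : 0 ≤ C) (hC : ∀ z, |f z| ≤ C) (n : ℕ) (z : Z) :
    maxBirkhoffSum R f n z ≤ n * C := by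
  induction n generalizing z with
  | zero => simp [maxBirkhoffSum]
  | succ n ih =>
    refine max_le (by positivity) ?_
    push_cast
    linarith [ih (R z), le_of_abs_le (hC z)]

/-- Sums over windows `[M, M + L]` which are a definite proportion of `[0, M + L]`. -/
lemma exists_forall_abs_sum_Icc_sub_le {f : Z → ℝ} {I : ℝ} {z : Z}
    (h : ∀ η > 0, ∃ N : ℕ, ∀ n ≥ N, |birkhoffSum R f n z - n * I| ≤ η * n)
    {η κ : ℝ} (hη : 0 < η) (hκ : 0 < κ) :
    ∃ N : ℕ, ∀ M L : ℕ, N ≤ M → 1 ≤ L → κ * M ≤ L →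
      |∑ n ∈ Finset.Icc M (M + L), f (R^[n] z) - (L + 1) * I| ≤ η * L := by
  -- The window is a difference of two initial segments of total length 2M + L + 1, which is at most
  -- (2/κ + 2)L because M ≤ L/κ and 1 ≤ L.
  obtain ⟨N, hN⟩ := h (η / (2 / κ + 2)) (by positivity)
  refine ⟨N, fun M L hM hL hκL => ?_⟩
  have h1 := hN M hM
  have h2 := hN (M + L + 1) (by omega)
  have hsum : ∑ n ∈ Finset.Icc M (M + L), f (R^[n] z)
      = birkhoffSum R f (M + L + 1) z - birkhoffSum R f M z := by
    rw [show Finset.Icc M (M + L) = Finset.Ico M (M + L + 1) from rfl,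
      Finset.sum_Ico_eq_sub _ (by omega)]
    rfl
  set θ := η / (2 / κ + 2)
  have hθ : θ * (2 / κ + 2) = η := div_mul_cancel₀ _ (by positivity)
  have hθ0 : 0 < θ := by positivity
  have hM' : (M : ℝ) ≤ L / κ := by rw [le_div_iff₀ hκ]; linarith
  have hL' : (1 : ℝ) ≤ L := by exact_mod_cast hL
  push_cast at h2
  have e : birkhoffSum R f (M + L + 1) z - birkhoffSum R f M z - (L + 1) * I
      = (birkhoffSum R f (M + L + 1) z - (M + L + 1) * I) - (birkhoffSum R f M z - M * I) := by
    ring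
  rw [hsum, e]
  refine (abs_sub _ _).trans ?_
  have h3 : θ * (2 * M + L + 1) ≤ θ * (2 * (L / κ) + 2 * L) := by
    gcongr θ * ?_; linarith
  have h4 : θ * (2 * (L / κ) + 2 * L) = η * L := by rw [← hθ]; ring
  linarith

variable [MeasurableSpace Z] {ρ : Measure Z}

lemma measurable_maxBirkhoffSum {f : Z → ℝ} (hR : Measurable R) (hf : Measurable f) (n : ℕ) :
    Measurable (maxBirkhoffSum R f n) := by
  induction n with
  | zero => exact measurable_const
  | succ n ih => exact measurable_const.max (hf.add (ih.comp hR))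

lemma integrable_of_abs_le [IsFiniteMeasure ρ] {f : Z → ℝ} (hf : Measurable f) {C : ℝ}
    (hC : ∀ z, |f z| ≤ C) : Integrable f ρ :=
  .of_bound hf.aestronglyMeasurable C (.of_forall hC)

/-- Birkhoff sums of a function of negative integral are almost everywhere bounded above. -/
lemma ae_bddAbove_birkhoffSum [IsProbabilityMeasure ρ] (hR : Ergodic R ρ) {f : Z → ℝ}
    (hf : Measurable f) {C : ℝ} (hC : ∀ z, |f z| ≤ C) (hneg : ∫ z, f z ∂ρ < 0) :
    ∀ᵐ z ∂ρ, ∃ B : ℝ, ∀ n, birkhoffSum R f n z ≤ B := by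
  have hC0 : 0 ≤ C := by
    have : Nonempty Z := nonempty_of_isProbabilityMeasure ρ
    exact (abs_nonneg _).trans (hC (Classical.arbitrary Z))
  set m := maxBirkhoffSum R f
  have hm := measurable_maxBirkhoffSum hR.measurable hf
  -- This set is invariant, so it is null or conull. If it is null, the monotone maximal sums
  -- converge almost everywhere and bound the Birkhoff sums.
  let A : Set Z := {z | Tendsto (fun n => m n z) atTop atTop}
  have hAm : MeasurableSet A := measurableSet_tendsto _ hm
  have hAiff : ∀ z, R z ∈ A ↔ z ∈ A := by
    intro z
    constructor
    · intro h
      refine (tendsto_add_atTop_iff_nat 1).1 ?_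
      exact tendsto_atTop_mono (fun n => le_max_right _ _)
        (tendsto_atTop_add_const_left _ (f z) h)
    · intro h
      have h1 := (tendsto_add_atTop_iff_nat 1).2 h
      refine tendsto_atTop_mono (fun n => ?_) (tendsto_atTop_add_const_right _ (-C) h1)
      have := maxBirkhoffSum_nonneg (R := R) f n (R z)
      have h2 : m (n + 1) z ≤ C + m n (R z) :=
        max_le (by positivity) (by linarith [le_of_abs_le (hC z)])
      linarith
  have hinv : R ⁻¹' A = A := Set.ext hAiff
  have hint : ∀ n, Integrable (m n) ρ := fun n => integrable_of_abs_le (hm n) (C := n * C) fun z => by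
    rw [abs_of_nonneg (maxBirkhoffSum_nonneg _ _ _)]
    exact maxBirkhoffSum_le hC0 hC n z
  rcases hR.measure_self_or_compl_eq_zero hAm hinv with h0 | h0
  · filter_upwards [measure_eq_zero_iff_ae_notMem.1 h0] with z hz
    rcases tendsto_atTop_of_monotone (maxBirkhoffSum_mono (R := R) f z) with h | ⟨l, hl⟩
    · exact absurd h hz
    · exact ⟨l, fun n => (birkhoffSum_le_maxBirkhoffSum f n z).trans
        ((maxBirkhoffSum_mono (R := R) f z).ge_of_tendsto hl n)⟩
  · exfalso
    have hfull : ∀ᵐ z ∂ρ, z ∈ A := mem_ae_iff.2 h0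
    -- In the conull case the right side converges to f, while the integral of the left side is
    -- nonnegative by monotonicity and invariance of ρ. This contradicts the negative integral of f.
    have key : ∀ n z, m (n + 1) z - m n (R z) = max (-m n (R z)) (f z) := by
      intro n z
      change max 0 (f z + m n (R z)) - m n (R z) = _
      rw [← max_sub_sub_right, zero_sub, add_sub_cancel_right]
    have hlim : Tendsto (fun n => ∫ z, max (-m n (R z)) (f z) ∂ρ) atTop (𝓝 (∫ z, f z ∂ρ)) := by
      refine tendsto_integral_of_dominated_convergence (fun _ => C)
        (fun n => (((hm n).comp hR.measurable).neg.max hf).aestronglyMeasurable)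
        (integrable_const _) (fun n => .of_forall fun z => ?_) ?_
      · rw [Real.norm_eq_abs, abs_le]
        have := maxBirkhoffSum_nonneg (R := R) f n (R z)
        exact ⟨le_max_of_le_right (neg_le_of_abs_le (hC z)),
          max_le (by linarith) (le_of_abs_le (hC z))⟩
      · filter_upwards [hfull] with z hz
        refine tendsto_const_nhds.congr' ?_
        filter_upwards [((hAiff z).2 hz).eventually_ge_atTop C] with n hn
        rw [max_eq_right]
        linarith [neg_le_of_abs_le (hC z)]
    refine absurd (ge_of_tendsto' hlim fun n => ?_) (not_le.2 hneg)
    simp_rw [← key]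
    have hcomp : ∫ z, m n (R z) ∂ρ = ∫ z, m n z ∂ρ := by
      conv_rhs => rw [← hR.toMeasurePreserving.map_eq]
      exact (integral_map hR.measurable.aemeasurable (hm n).aestronglyMeasurable).symm
    have hi : Integrable (fun z => m n (R z)) ρ :=
      hR.toMeasurePreserving.integrable_comp_of_integrable (hint n)
    rw [integral_sub (hint _) hi, hcomp, sub_nonneg]
    exact integral_mono (hint _) (hint _) fun z => maxBirkhoffSum_mono f z n.le_succ

/-- An upper bound in the pointwise ergodic theorem. -/
lemma ae_birkhoffSum_le [IsProbabilityMeasure ρ] (hR : Ergodic R ρ) {f : Z → ℝ}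
    (hf : Measurable f) {C : ℝ} (hC : ∀ z, |f z| ≤ C) :
    ∀ᵐ z ∂ρ, ∀ η > 0, ∃ N : ℕ, ∀ n ≥ N, birkhoffSum R f n z ≤ n * (∫ z, f z ∂ρ) + η * n := by
  set I := ∫ z, f z ∂ρ
  -- Subtracting slightly more than the mean makes the integral negative; countably many margins
  -- 1/(k + 1) keep a single null set.
  have h : ∀ k : ℕ, ∀ᵐ z ∂ρ, ∃ B : ℝ, ∀ n,
      birkhoffSum R (fun z => f z - (I + 1 / ((k : ℝ) + 1))) n z ≤ B := by
    intro k
    refine ae_bddAbove_birkhoffSum hR (hf.sub_const _) (C := C + |I + 1 / ((k : ℝ) + 1)|)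
      (fun z => (abs_sub _ _).trans (by linarith [hC z])) ?_
    rw [integral_sub (integrable_of_abs_le hf hC) (integrable_const _)]
    simp only [integral_const, probReal_univ, one_smul]
    have : (0 : ℝ) < 1 / ((k : ℝ) + 1) := by positivity
    linarith
  filter_upwards [ae_all_iff.2 h] with z hz η hη
  obtain ⟨k, hk⟩ := exists_nat_one_div_lt (half_pos hη)
  obtain ⟨B, hB⟩ := hz k
  obtain ⟨N, hN⟩ := exists_nat_ge (B / (η / 2))
  refine ⟨N, fun n hn => ?_⟩
  have h1 := hB n
  have h2 : birkhoffSum R (fun z => f z - (I + 1 / ((k : ℝ) + 1))) n z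
      = birkhoffSum R f n z - n * (I + 1 / ((k : ℝ) + 1)) := by
    simp only [birkhoffSum, Finset.sum_sub_distrib, Finset.sum_const, Finset.card_range, nsmul_eq_mul]
  rw [h2] at h1
  have h3 : B ≤ η / 2 * n := by
    rw [div_le_iff₀ (half_pos hη)] at hN
    have : (N : ℝ) ≤ n := by exact_mod_cast hn
    nlinarith
  have h4 : (n : ℝ) * (1 / ((k : ℝ) + 1)) ≤ n * (η / 2) := by gcongr
  nlinarith

/-- The pointwise ergodic theorem for bounded functions. -/
theorem ae_abs_birkhoffSum_sub_le [IsProbabilityMeasure ρ] (hR : Ergodic R ρ) {f : Z → ℝ}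
    (hf : Measurable f) {C : ℝ} (hC : ∀ z, |f z| ≤ C) :
    ∀ᵐ z ∂ρ, ∀ η > 0, ∃ N : ℕ, ∀ n ≥ N, |birkhoffSum R f n z - n * ∫ z, f z ∂ρ| ≤ η * n := by
  have hneg := ae_birkhoffSum_le hR hf.neg (C := C) (by simpa using hC)
  filter_upwards [ae_birkhoffSum_le hR hf hC, hneg] with z h1 h2 η hη
  obtain ⟨N₁, h1⟩ := h1 η hη
  obtain ⟨N₂, h2⟩ := h2 η hη
  refine ⟨max N₁ N₂, fun n hn => ?_⟩
  have h1 := h1 n (le_of_max_le_left hn)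
  have h2 := h2 n (le_of_max_le_right hn)
  have h3 : birkhoffSum R (-f) n z = -birkhoffSum R f n z := by simp [birkhoffSum]
  simp only [h3, Pi.neg_apply, integral_neg] at h2
  rw [abs_le]
  constructor <;> linarith

/-- A uniform version of the pointwise ergodic theorem for windows, for finitely many functions. -/
lemma exists_uniform_window [IsProbabilityMeasure ρ] (hR : Ergodic R ρ) {ι : Type*} [Finite ι]
    {f : ι → Z → ℝ} (hf : ∀ i, Measurable (f i)) (hC : ∀ i z, |f i z| ≤ 1)
    {η κ ε : ℝ} (hη : 0 < η) (hκ : 0 < κ) (hε : 0 < ε) :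
    ∃ N : ℕ, ∃ G : Set Z, MeasurableSet G ∧ 1 - ε < ρ.real G ∧ ∀ z ∈ G, ∀ M L : ℕ, N ≤ M → 1 ≤ L →
      κ * M ≤ L → ∀ i, |∑ n ∈ Finset.Icc M (M + L), f i (R^[n] z) - (L + 1) * ∫ z, f i z ∂ρ|
        ≤ η * L := by
  let G : ℕ → Set Z := fun N => {z | ∀ M L : ℕ, N ≤ M → 1 ≤ L →
      κ * M ≤ L → ∀ i, |∑ n ∈ Finset.Icc M (M + L), f i (R^[n] z) - (L + 1) * ∫ z, f i z ∂ρ|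
        ≤ η * L}
  have hGm : ∀ N, MeasurableSet (G N) := by
    intro N
    have : G N = ⋂ (M : ℕ) (L : ℕ) (_ : N ≤ M) (_ : 1 ≤ L) (_ : κ * M ≤ L) (i : ι),
        {z | |∑ n ∈ Finset.Icc M (M + L), f i (R^[n] z) - (L + 1) * ∫ z, f i z ∂ρ|
          ≤ η * L} := by
      ext z; simp [G]
    rw [this]
    refine .iInter fun M => .iInter fun L => .iInter fun _ => .iInter fun _ => .iInter fun _ =>
      .iInter fun i => ?_
    refine measurableSet_le (Measurable.abs (Measurable.sub_const ?_ _)) measurable_const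
    exact Finset.measurable_fun_sum _ fun n _ => (hf i).comp (hR.measurable.iterate n)
  have hmono : Monotone G := fun N N' h z hz M L hM => hz M L (h.trans hM)
  have hfull : ρ (⋃ N, G N) = 1 := by
    rw [← prob_compl_eq_zero_iff (.iUnion hGm)]
    change ∀ᵐ z ∂ρ, z ∈ ⋃ N, G N
    filter_upwards [ae_all_iff.2 fun i => ae_abs_birkhoffSum_sub_le hR (hf i) (hC i)] with z hz
    choose N hN using fun i => exists_forall_abs_sum_Icc_sub_le (hz i) hη hκ
    obtain ⟨N₀, hN₀⟩ := Set.Finite.bddAbove (Set.finite_range N)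
    refine mem_iUnion.2 ⟨N₀, fun M L hM hL hκL i => hN i M L ?_ hL hκL⟩
    exact (hN₀ ⟨i, rfl⟩).trans hM
  have hlim := tendsto_measure_iUnion_atTop (μ := ρ) hmono
  rw [hfull] at hlim
  have hlim' : Tendsto (fun N => ρ.real (G N)) atTop (𝓝 1) := by
    simpa [Function.comp_def] using! (ENNReal.tendsto_toReal ENNReal.one_ne_top).comp hlim
  obtain ⟨N, hN⟩ := (hlim'.eventually_const_lt (show 1 - ε < 1 by linarith)).exists
  exact ⟨N, G N, hGm N, hN, fun z hz => hz⟩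

end Birkhoff

/-! ### Sets and functions invariant under a dense set of times. -/

/-- A bounded measurable function on `ℝ` which is a.e. invariant under a dense set of translations
is a.e. constant. -/
lemma ae_eq_const_of_dense_translations {g : ℝ → ℝ} (hg : Measurable g) {C : ℝ}
    (hC : ∀ t, |g t| ≤ C) {H : Set ℝ} (hH : Dense H) (h : ∀ a ∈ H, ∀ᵐ t, g (t + a) = g t) :
    ∃ c, ∀ᵐ t, g t = c := by
  have hloc : LocallyIntegrable g volume :=
    (locallyIntegrable_const C).mono hg.aestronglyMeasurable (.of_forall fun t => by
      rw [Real.norm_eq_abs, Real.norm_eq_abs]; exact (hC t).trans (le_abs_self C))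
  have hint : ∀ a b : ℝ, IntervalIntegrable g volume a b := fun a b =>
    (hloc.integrableOn_isCompact isCompact_uIcc).intervalIntegrable
  set φ : ℝ → ℝ := fun x => ∫ u in (0 : ℝ)..x, g u
  have hφ : Continuous φ := intervalIntegral.continuous_primitive hint 0
  -- For a in H this is the invariance of g; both sides are continuous in a, so density gives every
  -- a. A continuous additive φ is linear, and its derivative is g almost everywhere.
  have hadd : ∀ a x, φ (x + a) = φ x + φ a := by
    intro a x
    have hcl : IsClosed {a | φ (x + a) = φ x + φ a} := isClosed_eq (by fun_prop) (by fun_prop)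
    refine hcl.closure_subset_iff.2 (fun a ha => ?_) (hH a)
    change (∫ u in (0 : ℝ)..x + a, g u) = (∫ u in (0 : ℝ)..x, g u) + ∫ u in (0 : ℝ)..a, g u
    rw [← intervalIntegral.integral_add_adjacent_intervals (hint 0 a) (hint a (x + a)), add_comm]
    congr 1
    have h1 : ∫ u in (0 : ℝ)..x, g (u + a) = ∫ u in a..x + a, g u := by simp
    rw [← h1]
    exact intervalIntegral.integral_congr_ae ((h a ha).mono fun t ht _ => ht)
  let Φ : ℝ →+ ℝ := AddMonoidHom.mk' φ fun a b => hadd b a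
  have hlin : ∀ x, φ x = φ 1 * x := fun x => by
    have := map_real_smul Φ hφ x 1
    simpa [Φ, mul_comm] using! this
  refine ⟨φ 1, ?_⟩
  filter_upwards [LocallyIntegrable.ae_hasDerivAt_integral hloc] with x hx
  have h1 : HasDerivAt φ (g x) x := hx 0
  have h2 : HasDerivAt φ (φ 1) x := by
    rw [show φ = fun x => φ 1 * x from funext hlin]
    simpa using (hasDerivAt_id x).const_mul (φ 1)
  exact h1.unique h2

section Flow

variable {Z : Type*} [MeasurableSpace Z] [AddAction ℝ Z] [MeasurableVAdd₂ ℝ Z] {ρ : Measure Z}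

/-- For an ergodic flow, a set invariant under a dense set of times is trivial. -/
lemma aeconst_of_dense_times [IsProbabilityMeasure ρ] [ErgodicVAdd ℝ Z ρ] {A : Set Z}
    (hA : MeasurableSet A) (hd : Dense {h : ℝ | (h +ᵥ ·) ⁻¹' A =ᵐ[ρ] A}) :
    EventuallyConst A (ae ρ) := by
  obtain ⟨H, hHsub, hHc, hHd⟩ := hd.exists_countable_dense_subset
  have hmeas : Measurable fun p : Z × ℝ => p.2 +ᵥ p.1 := measurable_snd.vadd measurable_fst
  have hS : MeasurableSet {p : Z × ℝ | p.2 +ᵥ p.1 ∈ A} := hmeas hA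
  have hline : ∀ᵐ z ∂ρ, (∀ᵐ t : ℝ, t +ᵥ z ∈ A) ∨ (∀ᵐ t : ℝ, t +ᵥ z ∉ A) := by
    have h1 : ∀ᵐ z ∂ρ, ∀ h ∈ H, ∀ᵐ t : ℝ, ((t + h) +ᵥ z ∈ A ↔ t +ᵥ z ∈ A) := by
      refine (ae_ball_iff hHc).2 fun h hh => ?_
      have hm : MeasurableSet {p : Z × ℝ | (p.2 + h) +ᵥ p.1 ∈ A ↔ p.2 +ᵥ p.1 ∈ A} := by
        have hm1 : Measurable fun p : Z × ℝ => (p.2 + h) +ᵥ p.1 :=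
          (measurable_snd.add_const h).vadd measurable_fst
        exact (hm1 hA).iff hS
      refine (Measure.ae_ae_comm hm).2 (.of_forall fun t => ?_)
      have h2 : ∀ᵐ z ∂ρ, (h +ᵥ z ∈ A ↔ z ∈ A) := by
        have h3 : (h +ᵥ ·) ⁻¹' A =ᵐ[ρ] A := mem_ofPred.1 (hHsub hh)
        filter_upwards [eventuallyEq_set.1 h3] with z hz using hz
      filter_upwards [(measurePreserving_vadd t ρ).quasiMeasurePreserving.ae h2] with z hz
      rw [add_comm, add_vadd]
      exact hz
    filter_upwards [h1] with z hz
    have hDm : MeasurableSet {t : ℝ | t +ᵥ z ∈ A} := (measurable_id.vadd_const z) hA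
    obtain ⟨c, hc⟩ := ae_eq_const_of_dense_translations (g := indicator {t : ℝ | t +ᵥ z ∈ A} 1)
      (measurable_one.indicator hDm) (C := 1) (fun t => by
        by_cases ht : t +ᵥ z ∈ A <;> simp [indicator, ht]) hHd (fun h hh => by
        filter_upwards [hz h hh] with t ht
        by_cases h5 : t +ᵥ z ∈ A <;> simp [indicator, ht, h5])
    by_cases h1 : c = 1
    · left
      filter_upwards [hc] with t ht
      by_contra hn
      simp [indicator, hn, h1] at ht
    · right
      filter_upwards [hc] with t ht hn
      simp [indicator, hn] at ht
      exact h1 ht.symm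
  -- This set is strictly invariant under every time, so ergodicity applies to it; Fubini transfers
  -- the conclusion back to A.
  let A' : Set Z := {z | ∀ᵐ t : ℝ, t +ᵥ z ∈ A}
  have hA' : MeasurableSet A' := by
    have := measurable_measure_prodMk_left (ν := (volume : Measure ℝ)) hS.compl
    exact this (measurableSet_singleton 0)
  have hinv : ∀ s : ℝ, (s +ᵥ ·) ⁻¹' A' = A' := by
    intro s
    ext z
    have : (∀ᵐ t : ℝ, (t + s) +ᵥ z ∈ A) ↔ ∀ᵐ t : ℝ, t +ᵥ z ∈ A := by
      constructor
      · intro h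
        have := (measurePreserving_add_right volume (-s)).quasiMeasurePreserving.ae h
        simpa using this
      · intro h
        exact (measurePreserving_add_right volume s).quasiMeasurePreserving.ae h
    simpa [A', add_vadd] using this
  have hsingle : ∀ {p : Z → Prop}, ∀ t : ℝ, (∀ᵐ z ∂ρ, p (t +ᵥ z)) → ∀ᵐ z ∂ρ, p z := by
    intro p t h
    have := (measurePreserving_vadd (-t) ρ).quasiMeasurePreserving.ae h
    simpa using this
  have hconst : EventuallyConst A' (ae ρ) :=
    aeconst_of_forall_preimage_vadd_ae_eq ℝ hA'.nullMeasurableSet fun s => .of_eq (hinv s)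
  rw [eventuallyConst_set]
  rcases eventuallyConst_set.1 hconst with h | h
  · left
    have h2 : ∀ᵐ t : ℝ, ∀ᵐ z ∂ρ, t +ᵥ z ∈ A := (Measure.ae_ae_comm hS).1 h
    obtain ⟨t, ht⟩ := h2.exists
    exact hsingle t ht
  · right
    have h1 : ∀ᵐ z ∂ρ, ∀ᵐ t : ℝ, t +ᵥ z ∉ A := by
      filter_upwards [h, hline] with z hz hz'
      exact hz'.resolve_left hz
    have h2 : ∀ᵐ t : ℝ, ∀ᵐ z ∂ρ, t +ᵥ z ∉ A := (Measure.ae_ae_comm hS.compl).1 h1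
    obtain ⟨t, ht⟩ := h2.exists
    exact hsingle (p := fun z => z ∉ A) t ht

/-- For an ergodic flow, functions invariant under two incommensurable times are constant. -/
lemma ae_eq_const_of_irrational [IsProbabilityMeasure ρ] [ErgodicVAdd ℝ Z ρ] {f : Z → ℝ}
    (hf : Measurable f) {a b : ℝ} (hab : Irrational (a / b))
    (ha : ∀ᵐ z ∂ρ, f (a +ᵥ z) = f z) (hb : ∀ᵐ z ∂ρ, f (b +ᵥ z) = f z) :
    ∃ c, f =ᵐ[ρ] Function.const Z c := by
  refine exists_eventuallyEq_const_of_forall_separating MeasurableSet fun U hU => ?_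
  refine eventuallyConst_set.1 (aeconst_of_dense_times (A := f ⁻¹' U) (hf hU) ?_)
  let S : AddSubgroup ℝ :=
    { carrier := {h : ℝ | ∀ᵐ z ∂ρ, f (h +ᵥ z) = f z}
      zero_mem' := by simp
      add_mem' := by
        intro h k hh hk
        rw [mem_ofPred] at hh hk ⊢
        filter_upwards [(measurePreserving_vadd k ρ).quasiMeasurePreserving.ae hh, hk] with z h1 h2
        rw [add_vadd, h1, h2]
      neg_mem' := by
        intro h hh
        rw [mem_ofPred] at hh ⊢
        filter_upwards [(measurePreserving_vadd (-h) ρ).quasiMeasurePreserving.ae hh] with z h1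
        simpa using h1.symm }
  have hSd : Dense (S : Set ℝ) := by
    refine (dense_addSubgroupClosure_pair_iff.2 hab).mono ?_
    rw [SetLike.coe_subset_coe, AddSubgroup.closure_le]
    rintro x (rfl | rfl)
    exacts [ha, hb]
  refine hSd.mono fun h hh => ?_
  refine mem_ofPred.2 (eventuallyEq_set.2 ?_)
  filter_upwards [show ∀ᵐ z ∂ρ, f (h +ᵥ z) = f z from mem_ofPred.1 hh] with z hz
  simp [hz]

end Flow

/-! ### Ergodicity of all but countably many time maps. -/

section Koopman

variable {Z : Type*} [MeasurableSpace Z] [AddAction ℝ Z] [MeasurableVAdd₂ ℝ Z] {ρ : Measure Z}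

/-- The Koopman operator `f ↦ f ∘ S_s` on `L²`. -/
noncomputable def koopman (ρ : Measure Z) [VAddInvariantMeasure ℝ Z ρ] (s : ℝ) :
    Lp ℝ 2 ρ →L[ℝ] Lp ℝ 2 ρ :=
  (Lp.compMeasurePreservingₗᵢ ℝ (s +ᵥ ·) (measurePreserving_vadd s ρ)).toContinuousLinearMap

lemma koopman_coeFn [VAddInvariantMeasure ℝ Z ρ] (s : ℝ) (f : Lp ℝ 2 ρ) :
    koopman ρ s f =ᵐ[ρ] fun z => f (s +ᵥ z) :=
  Lp.coeFn_compMeasurePreserving f (measurePreserving_vadd s ρ)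

lemma koopman_apply_eq_iff [VAddInvariantMeasure ℝ Z ρ] (s : ℝ) (f : Lp ℝ 2 ρ) :
    koopman ρ s f = f ↔ ∀ᵐ z ∂ρ, f (s +ᵥ z) = f z := by
  rw [Lp.ext_iff]
  constructor
  · intro h
    filter_upwards [h, koopman_coeFn s f] with z h1 h2
    rw [← h2, h1]
  · intro h
    filter_upwards [h, koopman_coeFn s f] with z h1 h2
    rw [h2, h1]

lemma koopman_comm [VAddInvariantMeasure ℝ Z ρ] (a b : ℝ) (f : Lp ℝ 2 ρ) :
    koopman ρ a (koopman ρ b f) = koopman ρ b (koopman ρ a f) := by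
  rw [Lp.ext_iff]
  filter_upwards [koopman_coeFn a (koopman ρ b f), koopman_coeFn b (koopman ρ a f),
    (measurePreserving_vadd a ρ).quasiMeasurePreserving.ae (koopman_coeFn b f),
    (measurePreserving_vadd b ρ).quasiMeasurePreserving.ae (koopman_coeFn a f)] with z h1 h2 h3 h4
  rw [h1, h2, h3, h4, vadd_vadd, vadd_vadd, add_comm]

/-- Functions invariant under incommensurable times of an ergodic flow are orthogonal. -/
lemma inner_eq_zero_of_irrational [IsProbabilityMeasure ρ] [ErgodicVAdd ℝ Z ρ] {f g : Lp ℝ 2 ρ}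
    {a b : ℝ} (hab : Irrational (a / b)) (hf : koopman ρ a f = f) (hg : koopman ρ b g = g)
    (hg0 : ∫ z, g z ∂ρ = 0) : inner ℝ f g = 0 := by
  -- By the mean ergodic theorem the projection of f to the b-invariant functions is a limit of
  -- averages of a-invariant functions. It is invariant under both times, hence constant, and so
  -- orthogonal to the mean-zero g.
  set V := (koopman ρ b).eqLocus (1 : Lp ℝ 2 ρ →L[ℝ] Lp ℝ 2 ρ)
  set q : Lp ℝ 2 ρ := (V.orthogonalProjectionOnto f : Lp ℝ 2 ρ)
  have hlim := (koopman ρ b).tendsto_birkhoffAverage_orthogonalProjection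
    (LinearIsometry.norm_toContinuousLinearMap_le _) f
  have hqb : koopman ρ b q = q := (V.orthogonalProjectionOnto f).2
  have hqa : koopman ρ a q = q := by
    have hiter : ∀ n : ℕ, koopman ρ a ((koopman ρ b)^[n] f) = (koopman ρ b)^[n] f := by
      intro n
      induction n with
      | zero => exact hf
      | succ n ih => rw [Function.iterate_succ_apply', koopman_comm, ih]
    have h1 := ((koopman ρ a).continuous.tendsto q).comp hlim
    refine tendsto_nhds_unique (h1.congr fun n => ?_) hlim
    simp [birkhoffAverage, birkhoffSum, map_sum, hiter]
  obtain ⟨c, hc⟩ := ae_eq_const_of_irrational (ρ := ρ) (f := q) (Lp.stronglyMeasurable q).measurable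
    hab ((koopman_apply_eq_iff a q).1 hqa) ((koopman_apply_eq_iff b q).1 hqb)
  have hproj : inner ℝ f g = inner ℝ q g := by
    have := V.inner_orthogonalProjectionOnto_eq_of_mem_left ⟨g, hg⟩ f
    rw [real_inner_comm, real_inner_comm g q]
    exact this.symm
  rw [hproj, L2.inner_def]
  have : ∫ z, inner ℝ (q z) (g z) ∂ρ = ∫ z, c * g z ∂ρ := by
    refine integral_congr_ae ?_
    filter_upwards [hc] with z hz
    simp [hz, mul_comm]
  rw [this, integral_const_mul, hg0, mul_zero]

/-- If the time-`s` map is not ergodic, it has a normalized nonconstant invariant function. -/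
lemma exists_invariant_of_not_ergodic [IsProbabilityMeasure ρ] [VAddInvariantMeasure ℝ Z ρ] {s : ℝ}
    (hs : ¬ Ergodic (fun z : Z => s +ᵥ z) ρ) :
    ∃ f : Lp ℝ 2 ρ, koopman ρ s f = f ∧ ∫ z, f z ∂ρ = 0 ∧ ‖f‖ = 1 := by
  have : ∃ A : Set Z, MeasurableSet A ∧ (s +ᵥ ·) ⁻¹' A = A ∧ ¬ EventuallyConst A (ae ρ) := by
    by_contra! h
    exact hs ⟨measurePreserving_vadd s ρ, ⟨fun A hA hinv => h A hA hinv⟩⟩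
  obtain ⟨A, hA, hinv, hconst⟩ := this
  let h : Z → ℝ := fun z => A.indicator 1 z - ρ.real A
  have hm : Measurable h := (measurable_one.indicator hA).sub_const _
  have hLp : MemLp h 2 ρ := (memLp_indicator_const 2 hA 1 (Or.inr (measure_ne_top _ _))).sub
    (memLp_const _)
  set v : Lp ℝ 2 ρ := hLp.toLp h
  have hv : v =ᵐ[ρ] h := hLp.coeFn_toLp
  have hv0 : v ≠ 0 := by
    intro h0
    refine hconst ?_
    have h1 : ∀ᵐ z ∂ρ, h z = 0 := by
      filter_upwards [hv, Lp.coeFn_zero ℝ 2 ρ] with z hz hz'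
      rw [← hz, h0, hz']; rfl
    rw [eventuallyConst_set]
    by_cases hA1 : ρ.real A = 0
    · right
      filter_upwards [h1] with z hz hzA
      simp [h, hzA, hA1] at hz
    · left
      filter_upwards [h1] with z hz
      by_contra hzA
      simp [h, hzA] at hz
      exact hA1 hz
  have hn : ‖v‖ ≠ 0 := norm_ne_zero_iff.2 hv0
  refine ⟨‖v‖⁻¹ • v, ?_, ?_, ?_⟩
  · rw [map_smul]
    congr 1
    rw [koopman_apply_eq_iff]
    filter_upwards [hv, (measurePreserving_vadd s ρ).quasiMeasurePreserving.ae hv] with z h1 h2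
    rw [h1, h2]
    have : s +ᵥ z ∈ A ↔ z ∈ A := Set.ext_iff.1 hinv z
    by_cases hz : z ∈ A <;> simp [h, indicator, this, hz]
  · have : ∫ z, (‖v‖⁻¹ • v : Lp ℝ 2 ρ) z ∂ρ = ∫ z, ‖v‖⁻¹ * h z ∂ρ := by
      refine integral_congr_ae ?_
      filter_upwards [hv, Lp.coeFn_smul ‖v‖⁻¹ v] with z h1 h2
      rw [h2, Pi.smul_apply, h1, smul_eq_mul]
    rw [this, integral_const_mul]
    have h0 : ∫ z, h z ∂ρ = 0 := by
      have hi : Integrable (A.indicator (1 : Z → ℝ)) ρ := (integrable_const (1 : ℝ)).indicator hA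
      simp only [h]
      rw [integral_sub hi (integrable_const _), integral_indicator_one hA]
      simp
    rw [h0, mul_zero]
  · rw [norm_smul, norm_inv, norm_norm, inv_mul_cancel₀ hn]

/-- All but countably many times of an ergodic flow are ergodic. -/
theorem countable_not_ergodic [MeasurableSpace.CountablyGenerated Z] [IsProbabilityMeasure ρ]
    [ErgodicVAdd ℝ Z ρ] : {s : ℝ | s ≠ 0 ∧ ¬ Ergodic (fun z : Z => s +ᵥ z) ρ}.Countable := by
  set B := {s : ℝ | s ≠ 0 ∧ ¬ Ergodic (fun z : Z => s +ᵥ z) ρ}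
  choose! f hf1 hf2 hf3 using fun (s : ℝ) (hs : ¬ Ergodic (fun z : Z => s +ᵥ z) ρ) =>
    exists_invariant_of_not_ergodic hs
  have : Fact ((2 : ENNReal) ≠ ⊤) := ⟨by simp⟩
  -- Unit vectors in a common ball of radius 1/2 are at distance below 1, whereas orthogonal ones
  -- are at distance √2. So the times in one ball are rational multiples of each other.
  have hcov : B ⊆ ⋃ k : ℕ, {s | s ∈ B ∧ dist (f s) (TopologicalSpace.denseSeq (Lp ℝ 2 ρ) k) < 1 / 2} := by
    intro s hs
    obtain ⟨k, hk⟩ := (TopologicalSpace.denseRange_denseSeq (Lp ℝ 2 ρ)).exists_dist_lt (f s)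
      (show (0 : ℝ) < 1 / 2 by norm_num)
    exact mem_iUnion.2 ⟨k, hs, hk⟩
  refine (countable_iUnion fun k => ?_).mono hcov
  rcases Set.eq_empty_or_nonempty
    {s | s ∈ B ∧ dist (f s) (TopologicalSpace.denseSeq (Lp ℝ 2 ρ) k) < 1 / 2} with h | ⟨b, hb, hbk⟩
  · rw [h]; exact countable_empty
  refine (countable_range fun q : ℚ => (q : ℝ) * b).mono ?_
  rintro a ⟨ha, hak⟩
  have hdist : dist (f a) (f b) < 1 := by
    linarith [dist_triangle_right (f a) (f b) (TopologicalSpace.denseSeq (Lp ℝ 2 ρ) k)]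
  have hrat : ¬ Irrational (a / b) := by
    intro hirr
    have h0 := inner_eq_zero_of_irrational hirr (hf1 a ha.2) (hf1 b hb.2) (hf2 b hb.2)
    have h1 := norm_sub_sq_real (f a) (f b)
    rw [h0, hf3 a ha.2, hf3 b hb.2, ← dist_eq_norm] at h1
    nlinarith [dist_nonneg (x := f a) (y := f b)]
  obtain ⟨q, hq⟩ : a / b ∈ range ((↑) : ℚ → ℝ) := not_not.1 hrat
  refine ⟨q, ?_⟩
  simp only [hq]
  exact div_mul_cancel₀ _ hb.1

end Koopman

/-! ### Weak mixing implies ergodicity of every nonzero time. -/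

/-- Two finite measures which agree on the algebra generated by a generating set agree. -/
lemma ext_of_generateSetAlgebra {X : Type*} [MeasurableSpace X] {μ₁ μ₂ : Measure X} [IsFiniteMeasure μ₁] (C : Set (Set X))
    (hC : MeasurableSpace.generateFrom C = ‹_›)
    (h : ∀ B ∈ generateSetAlgebra C, μ₁ B = μ₂ B) : μ₁ = μ₂ := by
  have halg := isSetAlgebra_generateSetAlgebra (𝒜 := C)
  refine ext_of_generate_finite (generateSetAlgebra C)
    (by rw [generateFrom_generateSetAlgebra_eq, hC]) (fun s hs t ht _ => halg.inter_mem hs ht) h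
    (h _ halg.univ_mem)

section WeakMixing

variable {X : Type*} [MeasurableSpace X] [AddAction ℝ X] [MeasurableVAdd₂ ℝ X] {μ : Measure X}

/-- If `g` is nonnegative and periodic and its averages tend to zero, it vanishes a.e. on a
period. -/
lemma ae_eq_zero_of_periodic_of_average {g : ℝ → ℝ} (hg : Measurable g) {C : ℝ}
    (hC : ∀ t, |g t| ≤ C) (hg0 : ∀ t, 0 ≤ g t) {s : ℝ} (hs : 0 < s) (hper : Function.Periodic g s)
    (hlim : Tendsto (fun T : ℝ => (1 / T) * ∫ t in (0 : ℝ)..T, g t) atTop (𝓝 0)) :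
    ∀ᵐ t ∂volume.restrict (Ioc 0 s), g t = 0 := by
  have hloc : LocallyIntegrable g volume :=
    (locallyIntegrable_const C).mono hg.aestronglyMeasurable (.of_forall fun t => by
      rw [Real.norm_eq_abs, Real.norm_eq_abs]; exact (hC t).trans (le_abs_self C))
  have hint : ∀ a b : ℝ, IntervalIntegrable g volume a b := fun a b =>
    (hloc.integrableOn_isCompact isCompact_uIcc).intervalIntegrable
  have hsub : Tendsto (fun n : ℕ => (n : ℝ) * s) atTop atTop :=
    tendsto_natCast_atTop_atTop.atTop_mul_const hs
  have h1 := hlim.comp hsub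
  have h2 : ∀ᶠ n : ℕ in atTop, (1 / s) * ∫ t in (0 : ℝ)..s, g t
      = ((fun T : ℝ => (1 / T) * ∫ t in (0 : ℝ)..T, g t) ∘ fun n : ℕ => (n : ℝ) * s) n := by
    filter_upwards [eventually_gt_atTop 0] with n hn
    have h3 := hper.intervalIntegral_add_zsmul_eq n 0 hint
    simp only [zero_add, natCast_zsmul, nsmul_eq_mul] at h3
    have hn' : (n : ℝ) ≠ 0 := by exact_mod_cast hn.ne'
    simp only [Function.comp, h3]
    field_simp
  have h4 : (1 / s) * ∫ t in (0 : ℝ)..s, g t = 0 :=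
    tendsto_nhds_unique (tendsto_const_nhds.congr' h2) h1
  have h5 : ∫ t in (0 : ℝ)..s, g t = 0 := by
    rcases mul_eq_zero.1 h4 with h | h
    · exact absurd h (by positivity)
    · exact h
  rw [intervalIntegral.integral_of_le hs.le] at h5
  exact (integral_eq_zero_iff_of_nonneg_ae (.of_forall hg0) (hint 0 s).1).1 h5

/-- The nonzero times of a weakly mixing flow are ergodic. -/
theorem ergodic_of_weaklyMixing [MeasurableSpace.CountablyGenerated X] [IsProbabilityMeasure μ]
    [VAddInvariantMeasure ℝ X μ] (hmix : WeaklyMixing μ) {s : ℝ} (hs : s ≠ 0) :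
    Ergodic (fun x : X => s +ᵥ x) μ := by
  refine ⟨measurePreserving_vadd s μ, ⟨fun {A} hA hinv => ?_⟩⟩
  wlog hpos : 0 < s generalizing s
  · refine this (s := -s) (neg_ne_zero.2 hs) ?_ (by
      rcases lt_or_gt_of_ne hs with h | h
      · linarith
      · exact absurd h hpos)
    nth_rw 1 [← hinv]
    ext x
    simp
  have himage : ∀ t : ℝ, (fun x : X => t +ᵥ x) '' A = (fun x => -t +ᵥ x) ⁻¹' A := fun t =>
    Set.ext fun x => by
      constructor
      · rintro ⟨y, hy, rfl⟩; simpa using hy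
      · intro hx; exact ⟨-t +ᵥ x, hx, by simp⟩
  have himm : ∀ t : ℝ, MeasurableSet ((fun x : X => t +ᵥ x) '' A) := fun t => by
    rw [himage]; exact measurable_const_vadd (-t) hA
  have himeas : ∀ t : ℝ, μ ((fun x : X => t +ᵥ x) '' A) = μ A := fun t => by
    rw [himage]; exact (measurePreserving_vadd (-t) μ).measure_preimage hA.nullMeasurableSet
  -- Since A is invariant under time s, the correlation with B is s-periodic in t; averages of a
  -- nonnegative periodic function tend to 0 only if it vanishes almost everywhere.
  have hzero : ∀ B, MeasurableSet B → ∀ᵐ t ∂volume.restrict (Ioc 0 s),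
      μ.real (((fun x : X => t +ᵥ x) '' A) ∩ B) = μ.real A * μ.real B := by
    intro B hB
    have hm : Measurable fun t : ℝ => μ.real (((fun x : X => t +ᵥ x) '' A) ∩ B) := by
      have hS : MeasurableSet {p : ℝ × X | -p.1 +ᵥ p.2 ∈ A ∧ p.2 ∈ B} :=
        (show Measurable fun p : ℝ × X => -p.1 +ᵥ p.2 from measurable_fst.neg.vadd measurable_snd) hA
          |>.inter (measurable_snd hB)
      have := (measurable_measure_prodMk_left (ν := μ) hS).ennreal_toReal
      convert this using 4 with t
      rw [himage]; rfl
    have h := ae_eq_zero_of_periodic_of_average ((hm.sub_const (μ.real A * μ.real B)).abs)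
      (C := 1) (fun t => ?_) (fun t => abs_nonneg _) hpos (fun t => ?_) (hmix A B hA hB)
    · filter_upwards [h] with t ht
      exact sub_eq_zero.1 (abs_eq_zero.1 ht)
    · have h1 : μ.real (((fun x : X => t +ᵥ x) '' A) ∩ B) ≤ 1 := measureReal_le_one
      have h2 : μ.real A * μ.real B ≤ 1 :=
        mul_le_one₀ measureReal_le_one measureReal_nonneg measureReal_le_one
      have h3 : 0 ≤ μ.real A * μ.real B := by positivity
      have h4 : 0 ≤ μ.real (((fun x : X => t +ᵥ x) '' A) ∩ B) := measureReal_nonneg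
      rw [abs_abs, abs_le]
      constructor <;> linarith
    · have : (fun x : X => (t + s) +ᵥ x) '' A = (fun x : X => t +ᵥ x) '' A := by
        rw [himage, himage]
        nth_rw 1 [← hinv]
        ext x
        simp [vadd_vadd]
      simp only [this]
  set C := MeasurableSpace.countableGeneratingSet X
  -- A countable generating algebra lets one t serve all B. Then S_t A is independent of every
  -- measurable set, in particular of itself.
  have hall : ∀ᵐ t ∂volume.restrict (Ioc 0 s), ∀ B ∈ generateSetAlgebra C,
      μ.real (((fun x : X => t +ᵥ x) '' A) ∩ B) = μ.real A * μ.real B := by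
    refine (ae_ball_iff
      (countable_generateSetAlgebra MeasurableSpace.countable_countableGeneratingSet)).2
      fun B hB => hzero B ?_
    have := MeasurableSpace.measurableSet_generateFrom hB
    rwa [generateFrom_generateSetAlgebra_eq,
      MeasurableSpace.generateFrom_countableGeneratingSet] at this
  have : (ae (volume.restrict (Ioc 0 s))).NeBot := by
    rw [ae_restrict_neBot]; simp [hpos]
  obtain ⟨t, ht⟩ := hall.exists
  have heq : μ.restrict ((fun x : X => t +ᵥ x) '' A) = μ A • μ := by
    refine ext_of_generateSetAlgebra C MeasurableSpace.generateFrom_countableGeneratingSet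
      fun B hB => ?_
    have hBm : MeasurableSet B := by
      have := MeasurableSpace.measurableSet_generateFrom hB
      rwa [generateFrom_generateSetAlgebra_eq,
        MeasurableSpace.generateFrom_countableGeneratingSet] at this
    rw [Measure.restrict_apply hBm, inter_comm, Measure.smul_apply, smul_eq_mul,
      ← ENNReal.toReal_eq_toReal_iff' (by finiteness) (by finiteness), ENNReal.toReal_mul]
    exact ht B hB
  have hsq : μ A = μ A * μ A := by
    have := congrArg (fun m : Measure X => m ((fun x : X => t +ᵥ x) '' A)) heq
    simpa [Measure.restrict_apply (himm t), himeas] using this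
  have h01 : μ A = 0 ∨ μ A = 1 := by
    by_cases h0 : μ A = 0
    · exact Or.inl h0
    · right
      have := (ENNReal.mul_eq_left (a := μ A) (b := μ A) h0 (measure_ne_top _ _)).1 hsq.symm
      exact this
  rw [eventuallyConst_set']
  rcases h01 with h | h
  · exact Or.inl (ae_eq_empty.2 h)
  · exact Or.inr (ae_eq_univ.2 ((prob_compl_eq_zero_iff hA).2 h))

end WeakMixing

/-! ### Recognising the product joining, and test functions for measures on X × Y. -/

/-- A joining which is invariant under `R × id`, with `R` ergodic, is the product. -/
theorem eq_prod_of_map_eq {X Y : Type*} [MeasurableSpace X] [MeasurableSpace Y] {μ : Measure X}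
    {ν : Measure Y} [IsProbabilityMeasure μ] [IsProbabilityMeasure ν] {ρ : Measure (X × Y)}
    [IsProbabilityMeasure ρ] (h1 : ρ.map Prod.fst = μ) (h2 : ρ.map Prod.snd = ν) {R : X → X}
    (hR : Ergodic R μ) (hinv : ρ.map (fun z => (R z.1, z.2)) = ρ) : ρ = μ.prod ν := by
  refine (Measure.prod_eq fun A B hA hB => ?_).symm
  set a : X → ℝ := A.indicator 1
  set b : Y → ℝ := B.indicator 1
  have ha : Measurable a := measurable_one.indicator hA
  have hb : Measurable b := measurable_one.indicator hB
  have ha1 : ∀ x, |a x| ≤ 1 := fun x => by by_cases hx : x ∈ A <;> simp [a, hx]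
  have hb1 : ∀ y, |b y| ≤ 1 := fun y => by by_cases hy : y ∈ B <;> simp [b, hy]
  -- These integrals do not depend on k, so they equal their averages, in which the ergodic theorem
  -- replaces a by the constant μ(A).
  have hprod : ∀ k, ∫ z, a (R^[k] z.1) * b z.2 ∂ρ = ρ.real (A ×ˢ B) := by
    intro k
    induction k with
    | zero =>
      rw [← integral_indicator_one (hA.prod hB)]
      congr 1; ext z
      by_cases h1 : z.1 ∈ A <;> by_cases h2 : z.2 ∈ B <;> simp [a, b, h1, h2, indicator]
    | succ k ih =>
      rw [← ih]
      conv_rhs => rw [← hinv]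
      rw [integral_map]
      · rfl
      · exact ((hR.measurable.comp measurable_fst).prodMk measurable_snd).aemeasurable
      · exact (((ha.comp (hR.measurable.iterate k)).comp measurable_fst).mul
          (hb.comp measurable_snd)).aestronglyMeasurable
  have hlim : Tendsto (fun n : ℕ => ∫ z, (n : ℝ)⁻¹ * birkhoffSum R a n z.1 * b z.2 ∂ρ) atTop
      (𝓝 (∫ z, μ.real A * b z.2 ∂ρ)) := by
    refine tendsto_integral_of_dominated_convergence (fun _ => 1) (fun n => ?_)
      (integrable_const _) (fun n => .of_forall fun z => ?_) ?_
    · have : Measurable (birkhoffSum R a n) :=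
        Finset.measurable_fun_sum _ fun k _ => ha.comp (hR.measurable.iterate k)
      exact (((this.comp measurable_fst).const_mul _).mul (hb.comp measurable_snd)).aestronglyMeasurable
    · have h3 : |birkhoffSum R a n z.1| ≤ n := by
        refine (Finset.abs_sum_le_sum_abs _ _).trans ?_
        refine (Finset.sum_le_sum fun k _ => ha1 _).trans ?_
        simp
      rw [norm_mul, norm_mul, norm_inv, Real.norm_natCast, Real.norm_eq_abs, Real.norm_eq_abs]
      have h4 : (n : ℝ)⁻¹ * |birkhoffSum R a n z.1| ≤ 1 := inv_mul_le_one_of_le₀ h3 (by positivity)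
      exact mul_le_one₀ h4 (abs_nonneg _) (hb1 _)
    · have hb := ae_abs_birkhoffSum_sub_le hR ha ha1
      rw [integral_indicator_one hA, ← h1] at hb
      rw [← h1]
      filter_upwards [ae_of_ae_map measurable_fst.aemeasurable hb] with z hz
      refine Tendsto.mul_const _ ?_
      rw [Metric.tendsto_atTop]
      intro ε hε
      obtain ⟨N, hN⟩ := hz (ε / 2) (half_pos hε)
      refine ⟨max N 1, fun n hn => ?_⟩
      have hn1 : (0 : ℝ) < n := by exact_mod_cast (le_of_max_le_right hn)
      have h5 := hN n (le_of_max_le_left hn)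
      rw [Real.dist_eq, ← mul_lt_mul_iff_right₀ hn1, ← abs_of_pos hn1, ← abs_mul, abs_of_pos hn1,
        mul_sub, mul_inv_cancel_left₀ hn1.ne']
      nlinarith
  have hconst : ∀ᶠ n : ℕ in atTop, ∫ z, (n : ℝ)⁻¹ * birkhoffSum R a n z.1 * b z.2 ∂ρ
      = ρ.real (A ×ˢ B) := by
    filter_upwards [eventually_gt_atTop 0] with n hn
    have hn' : (n : ℝ) ≠ 0 := by exact_mod_cast hn.ne'
    simp only [birkhoffSum, mul_assoc, Finset.sum_mul]
    rw [integral_const_mul, integral_finsetSum]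
    · simp only [hprod, Finset.sum_const, Finset.card_range, nsmul_eq_mul]
      exact inv_mul_cancel_left₀ hn' _
    · intro k _
      refine integrable_of_abs_le (C := 1) (((ha.comp (hR.measurable.iterate k)).comp
        measurable_fst).mul (hb.comp measurable_snd)) fun z => ?_
      rw [abs_mul]
      exact mul_le_one₀ (ha1 _) (abs_nonneg _) (hb1 _)
  have hfin : ρ.real (A ×ˢ B) = ∫ z, μ.real A * b z.2 ∂ρ :=
    tendsto_nhds_unique (tendsto_const_nhds.congr' (hconst.mono fun n hn => hn.symm)) hlim
  have hB2 : ∫ z, b z.2 ∂ρ = ν.real B := by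
    rw [← integral_indicator_one hB, ← h2, integral_map measurable_snd.aemeasurable
      hb.aestronglyMeasurable]
  rw [integral_const_mul, hB2] at hfin
  rw [← ENNReal.toReal_eq_toReal_iff' (by finiteness) (by finiteness), ENNReal.toReal_mul]
  exact hfin

/-- Finite measures on `X × Y` are separated by functions `f(x) 1_B(y)` with `f` Lipschitz. -/
lemma exists_lipschitz_integral_ne {X Y : Type*} [MetricSpace X] [MeasurableSpace X] [BorelSpace X]
    [MeasurableSpace Y] {ρ₁ ρ₂ : Measure (X × Y)} [IsFiniteMeasure ρ₁] [IsFiniteMeasure ρ₂]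
    (hne : ρ₁ ≠ ρ₂) :
    ∃ (f : X → ℝ) (K : NNReal) (B : Set Y), LipschitzWith K f ∧ (∀ x, 0 ≤ f x) ∧ (∀ x, f x ≤ 1) ∧
      MeasurableSet B ∧ ∫ z, f z.1 * B.indicator 1 z.2 ∂ρ₁ ≠ ∫ z, f z.1 * B.indicator 1 z.2 ∂ρ₂ := by
  by_contra! h
  refine hne ?_
  -- For fixed B this is a finite Borel measure on a metric space, determined by its values on
  -- closed sets, which are limits of integrals of Lipschitz thickened indicators.
  let m : Measure (X × Y) → Set Y → Measure X := fun ρ B => (ρ.restrict (univ ×ˢ B)).map Prod.fst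
  have hfin : ∀ (ρ : Measure (X × Y)) [IsFiniteMeasure ρ] (B : Set Y), IsFiniteMeasure (m ρ B) :=
    fun ρ _ B => by dsimp only [m]; infer_instance
  have hint : ∀ (ρ : Measure (X × Y)) (B : Set Y), MeasurableSet B → ∀ f : X → ℝ, Measurable f →
      ∫ x, f x ∂(m ρ B) = ∫ z, f z.1 * B.indicator 1 z.2 ∂ρ := by
    intro ρ B hB f hf
    rw [integral_map measurable_fst.aemeasurable hf.aestronglyMeasurable,
      ← integral_indicator (MeasurableSet.univ.prod hB)]
    congr 1; ext z
    by_cases hz : z.2 ∈ B <;> simp [indicator, hz]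
  have happly : ∀ (ρ : Measure (X × Y)) (A : Set X) (B : Set Y), MeasurableSet A →
      m ρ B A = ρ (A ×ˢ B) := by
    intro ρ A B hA
    rw [Measure.map_apply measurable_fst hA, Measure.restrict_apply (measurable_fst hA)]
    congr 1; ext z; simp
  have hB : ∀ B : Set Y, MeasurableSet B → m ρ₁ B = m ρ₂ B := by
    intro B hB
    have hcl : ∀ F : Set X, IsClosed F → m ρ₁ B F = m ρ₂ B F := by
      intro F hF
      have := hfin ρ₁ B
      have := hfin ρ₂ B
      have key := fun (ρ : Measure X) [IsFiniteMeasure ρ] =>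
        tendsto_integral_thickenedIndicator_of_isClosed ρ hF (δs := fun n : ℕ => (1 : ℝ) / (n + 1))
          (fun _ => by positivity) tendsto_one_div_add_atTop_nhds_zero_nat
      have heq : (m ρ₁ B).real F = (m ρ₂ B).real F := by
        refine tendsto_nhds_unique (key (m ρ₁ B)) ((key (m ρ₂ B)).congr fun n => ?_)
        have hδ : (0 : ℝ) < 1 / ((n : ℝ) + 1) := by positivity
        have hL : LipschitzWith _ fun x => (thickenedIndicator hδ F x : ℝ) :=
          lipschitzWith_thickenedIndicator hδ F
        rw [hint _ _ hB _ hL.continuous.measurable, hint _ _ hB _ hL.continuous.measurable]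
        exact (h _ _ B hL (fun x => NNReal.coe_nonneg _)
          (fun x => by exact_mod_cast thickenedIndicator_le_one hδ F x) hB).symm
      exact (measureReal_eq_measureReal_iff).1 heq
    have := hfin ρ₁ B
    refine ext_of_generate_finite {F : Set X | IsClosed F} ?_ isPiSystem_isClosed
      (fun F hF => hcl F hF) (hcl _ isClosed_univ)
    rw [BorelSpace.measurable_eq (α := X), borel_eq_generateFrom_isClosed]
  refine Measure.ext_prod fun {A B} hA hBm => ?_
  rw [← happly ρ₁ A B hA, ← happly ρ₂ A B hA, hB B hBm]

/-! ### Generic points of one fibre do not shadow each other with a shift. -/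

section Separation

variable {X Y : Type*} [MetricSpace X] [MeasurableSpace X] [BorelSpace X] [MeasurableSpace Y]
  [AddAction ℝ X] [MeasurableVAdd₂ ℝ X] [AddAction ℝ Y] {μ : Measure X} {ρ : Measure (X × Y)}

/-- Times `n ∈ [M, M + L]` at which the orbit of `x` is `ε`-close to the orbit of `x'` shifted by
`p`. -/
def closeTimes (t₀ ε : ℝ) (x x' : X) (p : ℝ) (M L : ℕ) : Set ℕ :=
  {n : ℕ | M ≤ n ∧ n ≤ M + L ∧ dist (((n : ℝ) * t₀) +ᵥ x) (((n : ℝ) * t₀ + p) +ᵥ x') < ε}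

/-- The Birkhoff sum of `h` along `z` over the window `[M, M + L]` is correct up to `ε L`. -/
def GenericOn (ρ : Measure (X × Y)) (t₀ ε : ℝ) (h : X × Y → ℝ) (M L : ℕ) (z : X × Y) : Prop :=
  |∑ n ∈ Finset.Icc M (M + L), h (((n : ℝ) * t₀) +ᵥ z) - (L + 1) * ∫ z, h z ∂ρ| ≤ ε * L

/-- If `ρ` is not invariant under `S_q × id`, then finitely many test functions rule out that the
orbits of two points of a fibre, both generic over a window, are close up to a shift near `q`. -/
theorem exists_separating [IsProbabilityMeasure μ] [VAddInvariantMeasure ℝ X μ]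
    [IsProbabilityMeasure ρ] (hρ : ρ.map Prod.fst = μ) (hcont : AlmostContinuous μ) {q : ℝ}
    (hne : ρ.map (fun z => (q +ᵥ z.1, z.2)) ≠ ρ) :
    ∃ ε : ℝ, 0 < ε ∧ ∃ h : Fin 3 → X × Y → ℝ, (∀ i, Measurable (h i)) ∧ (∀ i z, |h i z| ≤ 1) ∧
      ∃ r : ℝ, 0 < r ∧ ∀ p, |p - q| < r → ∀ (t₀ : ℝ) (x x' : X) (y : Y) (M L : ℕ), 1 ≤ ε * L →
        (∀ i, GenericOn ρ t₀ ε (h i) M L (x, y)) → (∀ i, GenericOn ρ t₀ ε (h i) M L (x', y)) →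
        ((closeTimes t₀ ε x x' p M L).ncard : ℝ) ≤ (1 - ε) * L := by
  have hshift : Measurable fun z : X × Y => (q +ᵥ z.1, z.2) :=
    ((measurable_const_vadd q).comp measurable_fst).prodMk measurable_snd
  have : IsProbabilityMeasure (ρ.map (fun z => (q +ᵥ z.1, z.2))) :=
    Measure.isProbabilityMeasure_map hshift.aemeasurable
  obtain ⟨f, K, B, hf, hf0, hf1, hB, hI⟩ := exists_lipschitz_integral_ne hne
  have hfm := hf.continuous.measurable
  set b : Y → ℝ := B.indicator 1
  have hbm : Measurable b := measurable_one.indicator hB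
  have hb0 : ∀ y, 0 ≤ b y := fun y => by by_cases hy : y ∈ B <;> simp [b, hy]
  have hb1 : ∀ y, b y ≤ 1 := fun y => by by_cases hy : y ∈ B <;> simp [b, hy]
  have hfb : Measurable fun z : X × Y => f z.1 * b z.2 :=
    (hfm.comp measurable_fst).mul (hbm.comp measurable_snd)
  rw [integral_map hshift.aemeasurable hfb.aestronglyMeasurable] at hI
  set I₁ := ∫ z, f z.1 * b z.2 ∂ρ
  set I₂ := ∫ z : X × Y, f (q +ᵥ z.1) * b z.2 ∂ρ
  set g := |I₁ - I₂|
  have hg : 0 < g := abs_pos.2 (sub_ne_zero.2 (Ne.symm hI))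
  -- On E a shift by p - q moves points so little that f changes by at most g/8; leaving E costs at
  -- most another g/8 on average.
  obtain ⟨E, hE, hμE, hEc⟩ := hcont (g / 8) (by positivity)
  obtain ⟨r, hr, hrE⟩ := hEc (g / (8 * (K + 1))) (by positivity)
  set e : X → ℝ := E.indicator 1
  have hem : Measurable e := measurable_one.indicator hE
  have hint : ∫ z : X × Y, e (q +ᵥ z.1) ∂ρ = μ.real E := by
    have h1 : Measurable fun x : X => e (q +ᵥ x) := hem.comp (measurable_const_vadd q)
    have h2 := integral_map (measurable_fst.aemeasurable (μ := ρ)) h1.aestronglyMeasurable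
    have h3 := integral_map ((measurable_const_vadd q).aemeasurable (μ := μ))
      hem.aestronglyMeasurable
    rw [hρ] at h2
    rw [(measurePreserving_vadd q μ).map_eq, integral_indicator_one hE] at h3
    rw [← h2, ← h3]
  -- The errors are 3ε from genericity of the three test functions, 2ε from the times that are not
  -- close (one ε absorbs the extra term of the window, as 1 ≤ εL), Kε from closeness and g/4 from
  -- E. Their sum g/2 is below the gap g.
  have hε0 : 0 < g / (4 * (5 + K)) := by positivity
  set ε := g / (4 * (5 + K)) with hεdef
  refine ⟨ε, hε0, ![fun z => f z.1 * b z.2, fun z => f (q +ᵥ z.1) * b z.2, fun z => e (q +ᵥ z.1)],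
    ?_, ?_, r, hr, ?_⟩
  · intro i
    fin_cases i
    · exact hfb
    · exact (hfm.comp ((measurable_const_vadd q).comp measurable_fst)).mul (hbm.comp measurable_snd)
    · exact hem.comp ((measurable_const_vadd q).comp measurable_fst)
  · have hfb1 : ∀ x y, |f x * b y| ≤ 1 := fun x y => by
      rw [abs_of_nonneg (mul_nonneg (hf0 x) (hb0 y))]
      exact mul_le_one₀ (hf1 x) (hb0 y) (hb1 y)
    intro i z
    fin_cases i
    · exact hfb1 _ _
    · exact hfb1 _ _
    · by_cases hz : q +ᵥ z.1 ∈ E <;> simp [e, hz]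
  intro p hp t₀ x x' y M L hL hx hx'
  by_contra! hcard
  have g0 := hx 0
  have g1 := hx' 1
  have g2 := hx' 2
  simp only [GenericOn, Matrix.cons_val] at g0 g1 g2
  rw [hint] at g2
  set S := Finset.Icc M (M + L)
  have hScard : (S.card : ℝ) = L + 1 := by
    rw [Nat.card_Icc, show M + L + 1 - M = L + 1 by omega]; push_cast; rfl
  let near : ℕ → ℝ := (closeTimes t₀ ε x x' p M L).indicator 1
  have hnear : ∑ n ∈ S, near n = (closeTimes t₀ ε x x' p M L).ncard := by
    classical
    have : closeTimes t₀ ε x x' p M L = ↑(S.filter (· ∈ closeTimes t₀ ε x x' p M L)) := by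
      ext n
      rw [Finset.mem_coe, Finset.mem_filter, Finset.mem_Icc]
      exact ⟨fun h => ⟨⟨h.1, h.2.1⟩, h⟩, fun h => h.2⟩
    rw [this, Set.ncard_coe_finset, Finset.card_filter]
    push_cast
    refine Finset.sum_congr rfl fun n _ => ?_
    simp only [near, indicator, Pi.one_apply]
  have hbd : ∀ u v, |f u - f v| ≤ 1 := fun u v => by
    rw [abs_le]; constructor <;> linarith [hf0 u, hf1 u, hf0 v, hf1 v]
  have hterm : ∀ n ∈ S, |f (((n : ℝ) * t₀ +ᵥ (x, y)).1) * b ((n : ℝ) * t₀ +ᵥ (x, y)).2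
      - f (q +ᵥ ((n : ℝ) * t₀ +ᵥ (x', y)).1) * b ((n : ℝ) * t₀ +ᵥ (x', y)).2|
      ≤ (K * ε + (1 - near n)) + (g / 8 + (1 - e (q +ᵥ ((n : ℝ) * t₀ +ᵥ (x', y)).1))) := by
    intro n hn
    simp only [Prod.vadd_mk]
    rw [← sub_mul, abs_mul, abs_of_nonneg (hb0 _)]
    refine (mul_le_of_le_one_right (abs_nonneg _) (hb1 _)).trans ?_
    refine (abs_sub_le _ (f (((n : ℝ) * t₀ + p) +ᵥ x')) _).trans (add_le_add ?_ ?_)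
    · by_cases hc : n ∈ closeTimes t₀ ε x x' p M L
      · have h1 := hf.dist_le_mul (((n : ℝ) * t₀) +ᵥ x) (((n : ℝ) * t₀ + p) +ᵥ x')
        rw [Real.dist_eq] at h1
        have h2 : (K : ℝ) * dist (((n : ℝ) * t₀) +ᵥ x) (((n : ℝ) * t₀ + p) +ᵥ x') ≤ K * ε := by
          gcongr; exact hc.2.2.le
        simp only [near, indicator_of_mem hc, Pi.one_apply]
        linarith
      · simp only [near, indicator_of_notMem hc]
        have : 0 ≤ (K : ℝ) * ε := by positivity
        linarith [hbd (((n : ℝ) * t₀) +ᵥ x) (((n : ℝ) * t₀ + p) +ᵥ x')]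
    · set w := q +ᵥ ((n : ℝ) * t₀) +ᵥ x'
      have hw : ((n : ℝ) * t₀ + p) +ᵥ x' = (p - q) +ᵥ w := by
        simp only [w, vadd_vadd]; congr 1; ring
      rw [hw]
      by_cases hc : w ∈ E
      · have h1 := hf.dist_le_mul ((p - q) +ᵥ w) w
        rw [Real.dist_eq] at h1
        have h2 := hrE w hc (p - q) (by rw [mem_Icc, ← abs_le]; exact hp.le) 0
          ⟨by linarith, hr.le⟩
        rw [zero_vadd] at h2
        have h3 : (K : ℝ) * dist ((p - q) +ᵥ w) w ≤ (K + 1) * (g / (8 * (K + 1))) := by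
          gcongr; linarith
        have h4 : ((K : ℝ) + 1) * (g / (8 * (K + 1))) = g / 8 := by field_simp
        simp only [e, indicator_of_mem hc, Pi.one_apply]
        linarith
      · simp only [e, indicator_of_notMem hc]
        linarith [hbd ((p - q) +ᵥ w) w]
  have hsum := (Finset.abs_sum_le_sum_abs _ S).trans (Finset.sum_le_sum hterm)
  simp only [Finset.sum_sub_distrib, Finset.sum_add_distrib, Finset.sum_const, nsmul_eq_mul,
    hScard, hnear, mul_one] at hsum
  have htri : (L + 1) * g ≤ ε * L + ε * L + |∑ n ∈ S, f (((n : ℝ) * t₀ +ᵥ (x, y)).1)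
      * b ((n : ℝ) * t₀ +ᵥ (x, y)).2 - ∑ n ∈ S, f (q +ᵥ ((n : ℝ) * t₀ +ᵥ (x', y)).1)
      * b ((n : ℝ) * t₀ +ᵥ (x', y)).2| := by
    have hL0 : (0 : ℝ) ≤ L + 1 := by positivity
    calc (L + 1) * g = |(L + 1) * I₁ - (L + 1) * I₂| := by
          rw [← mul_sub, abs_mul, abs_of_nonneg hL0]
      _ ≤ _ := by
          rw [abs_le] at g0 g1
          refine abs_le.2 ⟨?_, ?_⟩
          · linarith [neg_abs_le (∑ n ∈ S, f (((n : ℝ) * t₀ +ᵥ (x, y)).1)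
              * b ((n : ℝ) * t₀ +ᵥ (x, y)).2 - ∑ n ∈ S, f (q +ᵥ ((n : ℝ) * t₀ +ᵥ (x', y)).1)
              * b ((n : ℝ) * t₀ +ᵥ (x', y)).2)]
          · linarith [le_abs_self (∑ n ∈ S, f (((n : ℝ) * t₀ +ᵥ (x, y)).1)
              * b ((n : ℝ) * t₀ +ᵥ (x, y)).2 - ∑ n ∈ S, f (q +ᵥ ((n : ℝ) * t₀ +ᵥ (x', y)).1)
              * b ((n : ℝ) * t₀ +ᵥ (x', y)).2)]
  have hεg : (5 + K) * ε = g / 4 := by rw [hεdef]; field_simp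
  rw [abs_le] at g2
  have hL0 : (0 : ℝ) ≤ L := by positivity
  nlinarith

end Separation

/-! ### Uniform separation of the points of a fibre. -/

lemma vadd_iterate_eq {Z : Type*} [AddAction ℝ Z] (t : ℝ) (n : ℕ) (z : Z) :
    (fun z : Z => t +ᵥ z)^[n] z = ((n : ℝ) * t) +ᵥ z := by
  induction n with
  | zero => simp
  | succ n ih =>
    rw [Function.iterate_succ_apply', ih, vadd_vadd]
    push_cast
    congr 1; ring

lemma closeTimes_finite {X : Type*} [MetricSpace X] [AddAction ℝ X] (t₀ ε : ℝ) (x x' : X) (p : ℝ)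
    (M L : ℕ) : (closeTimes t₀ ε x x' p M L).Finite :=
  (Set.finite_Icc M (M + L)).subset fun _ hn => ⟨hn.1, hn.2.1⟩

section Separated

variable {X Y : Type*} [MetricSpace X] [MeasurableSpace X] [BorelSpace X] [MeasurableSpace Y]
  [AddAction ℝ X] [MeasurableVAdd₂ ℝ X] [AddAction ℝ Y] {μ : Measure X} {ρ : Measure (X × Y)}

/-- Two generic points of a fibre are not on a common orbit. -/
lemma exists_generic_set [IsProbabilityMeasure μ] [VAddInvariantMeasure ℝ X μ]
    [IsProbabilityMeasure ρ] (hρ : ρ.map Prod.fst = μ) (hcont : AlmostContinuous μ)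
    (hne : ∀ q : ℝ, q ≠ 0 → ρ.map (fun z => (q +ᵥ z.1, z.2)) ≠ ρ) {t₀ : ℝ}
    (herg : Ergodic (fun z : X × Y => t₀ +ᵥ z) ρ) :
    ∃ G : Set (X × Y), MeasurableSet G ∧ ρ Gᶜ = 0 ∧ ∀ x x' y, (x, y) ∈ G → (x', y) ∈ G →
      x' ∈ AddAction.orbit ℝ x → x' = x := by
  choose! ε hε h hm hb r hr key using fun q (hq : q ≠ 0) => exists_separating hρ hcont (hne q hq)
  -- Countably many q cover all nonzero shifts, so genericity for all their test functions costs
  -- only a null set.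
  obtain ⟨T, hT0, hTc, hTcov⟩ := TopologicalSpace.countable_cover_nhdsWithin
    (f := fun q : ℝ => Metric.ball q (r q)) (s := {0}ᶜ)
    fun q hq => mem_nhdsWithin_of_mem_nhds (Metric.ball_mem_nhds q (hr q hq))
  have hae : ∀ᵐ z ∂ρ, ∀ q ∈ T, ∀ i, ∀ η > 0, ∃ N : ℕ, ∀ n ≥ N,
      |birkhoffSum (fun z : X × Y => t₀ +ᵥ z) (h q i) n z - n * ∫ z, h q i z ∂ρ| ≤ η * n :=
    (ae_ball_iff hTc).2 fun q hq => ae_all_iff.2 fun i =>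
      ae_abs_birkhoffSum_sub_le herg (hm q (hT0 hq) i) (hb q (hT0 hq) i)
  obtain ⟨G', hG', hG'm, hG'0⟩ := exists_measurable_superset_of_null (ae_iff.1 hae)
  refine ⟨G'ᶜ, hG'm.compl, by rwa [compl_compl], fun x x' y hx hx' hmem => ?_⟩
  have hgen : ∀ z ∈ G'ᶜ, _ := fun z hz => not_not.1 fun hn => hz (hG' hn)
  by_contra hxx
  obtain ⟨t, rfl⟩ := hmem
  have ht : -t ≠ 0 := by
    rintro h0
    rw [neg_eq_zero] at h0
    exact hxx (by simp [h0])
  obtain ⟨q, hqT, hq⟩ := mem_iUnion₂.1 (hTcov ht)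
  have hq0 : q ≠ 0 := hT0 hqT
  have hwin : ∀ z ∈ G'ᶜ, ∃ N : ℕ, ∀ L ≥ N, 1 ≤ L → ∀ i, GenericOn ρ t₀ (ε q) (h q i) L L z := by
    intro z hz
    choose N hN using fun i => exists_forall_abs_sum_Icc_sub_le (hgen z hz q hqT i) (hε q hq0)
      one_pos
    obtain ⟨N₀, hN₀⟩ := (Set.finite_range N).bddAbove
    refine ⟨N₀, fun L hL hL1 i => ?_⟩
    have := hN i L L ((hN₀ ⟨i, rfl⟩).trans hL) hL1 (by rw [one_mul])
    simpa only [GenericOn, vadd_iterate_eq] using this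
  obtain ⟨N₁, hN₁⟩ := hwin _ hx
  obtain ⟨N₂, hN₂⟩ := hwin _ hx'
  obtain ⟨N₃, hN₃⟩ := exists_nat_ge (1 / ε q)
  set L := max (max N₁ N₂) (max N₃ 1)
  have hL1 : 1 ≤ L := le_max_of_le_right (le_max_right _ _)
  have hL3 : 1 ≤ ε q * L := by
    have h1 : (N₃ : ℝ) ≤ L := by exact_mod_cast le_max_of_le_right (le_max_left _ _)
    have := hN₃.trans h1
    rw [div_le_iff₀ (hε q hq0)] at this
    linarith
  have hle := key q hq0 (-t) (by rwa [← Real.dist_eq]) t₀ x (t +ᵥ x) y L L hL3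
    (hN₁ L (le_max_of_le_left (le_max_left _ _)) hL1)
    (hN₂ L (le_max_of_le_left (le_max_right _ _)) hL1)
  -- The shift -t undoes the displacement along the orbit, so every one of the L + 1 times is close.
  have hall : closeTimes t₀ (ε q) x (t +ᵥ x) (-t) L L = ↑(Finset.Icc L (L + L)) := by
    ext n
    rw [Finset.mem_coe, Finset.mem_Icc]
    refine ⟨fun hn => ⟨hn.1, hn.2.1⟩, fun hn => ⟨hn.1, hn.2, ?_⟩⟩
    rw [vadd_vadd, neg_add_cancel_right, dist_self]
    exact hε q hq0
  rw [hall, Set.ncard_coe_finset, Nat.card_Icc, show L + L + 1 - L = L + 1 by omega] at hle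
  push_cast at hle
  linarith

/-- On a set of positive measure, distinct points of a fibre are uniformly separated. -/
theorem exists_separated_set [IsProbabilityMeasure μ] [VAddInvariantMeasure ℝ X μ]
    [IsProbabilityMeasure ρ] (hρ : ρ.map Prod.fst = μ) (hcont : AlmostContinuous μ)
    (hne : ∀ q : ℝ, q ≠ 0 → ρ.map (fun z => (q +ᵥ z.1, z.2)) ≠ ρ) {P : Set ℝ} (hP : IsCompact P)
    (hP0 : (0 : ℝ) ∉ P) {t₀ : ℝ} (hR : RatnerAt μ t₀ P)
    (herg : Ergodic (fun z : X × Y => t₀ +ᵥ z) ρ) :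
    ∃ E : Set (X × Y), MeasurableSet E ∧ 0 < ρ E ∧ ∃ δ : ℝ, 0 < δ ∧
      ∀ x x' y, (x, y) ∈ E → (x', y) ∈ E → x ≠ x' → δ ≤ dist x x' := by
  obtain ⟨G₀, hG₀m, hG₀, horb⟩ := exists_generic_set hρ hcont hne herg
  choose! ε hε h hm hb r hr key using fun q (hq : q ≠ 0) => exists_separating hρ hcont (hne q hq)
  have hPne : ∀ q ∈ P, q ≠ 0 := fun q hq h0 => hP0 (h0 ▸ hq)
  obtain ⟨F, hFP, hFcov⟩ := hP.elim_nhds_subcover (fun q : ℝ => Metric.ball q (r q))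
    fun q hq => Metric.ball_mem_nhds q (hr q (hPne q hq))
  -- The bound 1/4 gives Z and G measure above 3/4 each, so they meet in positive measure.
  obtain ⟨ε₀, hε₀F, hε₀4, hε₀⟩ : ∃ e : ℝ, (∀ q ∈ F, e ≤ ε q) ∧ e ≤ 1 / 4 ∧ 0 < e := by
    have h1 : ∀ᶠ e : ℝ in 𝓝[>] 0, ∀ q ∈ F, e ≤ ε q := (Finset.eventually_all F).2 fun q hq =>
      mem_nhdsWithin_of_mem_nhds (Iic_mem_nhds (hε q (hPne q (hFP q hq))))
    have h2 : ∀ᶠ e : ℝ in 𝓝[>] 0, e ≤ 1 / 4 :=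
      mem_nhdsWithin_of_mem_nhds (Iic_mem_nhds (by norm_num))
    exact (h1.and (h2.and self_mem_nhdsWithin)).exists
  -- The order matters: ε₀ determines κ, then κ determines the threshold N₀ of the ergodic theorem,
  -- and only then are δ and Z chosen.
  obtain ⟨κ, hκ, hκN⟩ := hR.2 ε₀ hε₀
  obtain ⟨N₀, G, hGm, hG, hGgen⟩ := exists_uniform_window herg (ι := F × Fin 3)
    (f := fun j => h j.1 j.2) (fun j => hm _ (hPne _ (hFP _ j.1.2)) _)
    (fun j => hb _ (hPne _ (hFP _ j.1.2)) _) hε₀ hκ (ε := 1 / 4) (by norm_num)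
  obtain ⟨N₁, hN₁⟩ := exists_nat_ge (1 / ε₀)
  obtain ⟨δ, hδ, Z, hZm, hZ, hZR⟩ := hκN (max N₀ (max N₁ 1))
  have hZm' : MeasurableSet (Prod.fst ⁻¹' Z : Set (X × Y)) := measurable_fst hZm
  have hZρ : ρ.real (Prod.fst ⁻¹' Z) = μ.real Z := by
    rw [← hρ, map_measureReal_apply measurable_fst hZm]
  refine ⟨G ∩ Prod.fst ⁻¹' Z ∩ G₀, (hGm.inter hZm').inter hG₀m, ?_, δ, hδ, ?_⟩
  · rw [measure_inter_conull hG₀]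
    have h1 := measureReal_union_add_inter (μ := ρ) (s := G) hZm'
    have h2 : ρ.real (G ∪ Prod.fst ⁻¹' Z) ≤ 1 := measureReal_le_one
    have h3 : 0 < ρ.real (G ∩ Prod.fst ⁻¹' Z) := by linarith
    exact (ENNReal.toReal_pos_iff.1 h3).1
  · rintro x x' y ⟨⟨hxG, hxZ⟩, hx0⟩ ⟨⟨hxG', hxZ'⟩, hx0'⟩ hxx
    by_contra! hlt
    obtain ⟨M, L, hM, hL, hML, p, hp, hcount⟩ := hZR x hxZ x' hxZ'
      (fun ho => hxx (horb x x' y hx0 hx0' ho).symm) hlt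
    obtain ⟨q, hqF, hq⟩ := mem_iUnion₂.1 (hFcov hp)
    have hq0 : q ≠ 0 := hPne q (hFP q hqF)
    have hM1 : (0 : ℝ) < M := by
      exact_mod_cast (le_max_of_le_right (le_max_right _ _)).trans hM
    have hL1 : 1 ≤ L := (le_max_of_le_right (le_max_right _ _)).trans hL
    have hL1' : (0 : ℝ) < L := by exact_mod_cast hL1
    have hLε : 1 ≤ ε₀ * L := by
      have h1 : (N₁ : ℝ) ≤ L := by
        exact_mod_cast (le_max_of_le_right (le_max_left _ _)).trans hL
      have := hN₁.trans h1
      rw [div_le_iff₀ hε₀] at this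
      linarith
    rw [le_div_iff₀ hM1] at hML
    have hεq := hε₀F q hqF
    have hgen : ∀ z ∈ G, ∀ i, GenericOn ρ t₀ (ε q) (h q i) M L z := by
      intro z hz i
      have := hGgen z hz M L ((le_max_left _ _).trans hM) hL1 hML (⟨q, hqF⟩, i)
      simp only [vadd_iterate_eq] at this
      exact this.trans (by gcongr)
    have hle := key q hq0 p (by rwa [← Real.dist_eq]) t₀ x x' y M L (hLε.trans (by gcongr))
      (hgen _ hxG) (hgen _ hxG')
    rw [lt_div_iff₀ hL1'] at hcount
    have hsub : (closeTimes t₀ ε₀ x x' p M L).ncard ≤ (closeTimes t₀ (ε q) x x' p M L).ncard :=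
      Set.ncard_le_ncard (fun n hn => ⟨hn.1, hn.2.1, hn.2.2.trans_le hεq⟩)
        (closeTimes_finite _ _ _ _ _ _ _)
    have hsub' : ((closeTimes t₀ ε₀ x x' p M L).ncard : ℝ)
        ≤ (closeTimes t₀ (ε q) x x' p M L).ncard := by exact_mod_cast hsub
    have hcount' : (1 - ε₀) * L < ((closeTimes t₀ ε₀ x x' p M L).ncard : ℝ) := hcount
    nlinarith

end Separated

/-! ### From countable to finite fibres through conditional measures. -/

/-- A `σ`-compact metric space with its Borel `σ`-algebra is standard Borel. -/
theorem standardBorelSpace_of_sigmaCompact (X : Type*) [MetricSpace X] [SigmaCompactSpace X]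
    [MeasurableSpace X] [BorelSpace X] : StandardBorelSpace X := by
  let C := UniformSpace.Completion X
  borelize C
  let ι : X → C := fun x => (x : C)
  have hemb : IsEmbedding ι := UniformSpace.Completion.isUniformEmbedding_coe X |>.isEmbedding
  -- The image in the completion is a countable union of compact sets, hence Borel in a space where
  -- Borel subsets are standard.
  have hrange : MeasurableSet (range ι) := by
    rw [← image_univ, ← iUnion_compactCovering, image_iUnion]
    exact .iUnion fun n => ((isCompact_compactCovering X n).image hemb.continuous).measurableSet
  have hSB : StandardBorelSpace (range ι) := hrange.standardBorel
  let e : X ≃ᵐ range ι := hemb.toHomeomorph.toMeasurableEquiv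
  obtain ⟨τ, hτb, hτp⟩ := hSB.polish
  refine ⟨⟨τ.induced e, ?_, e.toEquiv.polishSpace_induced⟩⟩
  refine @BorelSpace.mk _ (τ.induced e) _ ?_
  rw [@borel_comap X (range ι) e τ, ← hτb.measurable_eq]
  exact e.measurableEmbedding.comap_eq.symm

instance {X Y : Type*} [MeasurableSpace X] [MeasurableSpace Y] [AddAction ℝ X] [AddAction ℝ Y]
    [MeasurableVAdd₂ ℝ X] [MeasurableVAdd₂ ℝ Y] : MeasurableVAdd₂ ℝ (X × Y) where
  measurable_vadd :=
    (measurable_fst.vadd (measurable_fst.comp measurable_snd)).prodMk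
      (measurable_fst.vadd (measurable_snd.comp measurable_snd))

section Fibres

variable {X Y : Type*} [MeasurableSpace X] [StandardBorelSpace X] [MeasurableSpace Y]
  [AddAction ℝ X] [MeasurableVAdd₂ ℝ X] [AddAction ℝ Y] [MeasurableVAdd₂ ℝ Y]
  {ρ : Measure (X × Y)}

/-- If the product flow is ergodic and a set of positive measure has countable fibres over `Y`,
then almost every fibre of `X × Y → Y` is finite. -/
theorem finiteToOneAE_of_countable_fibres [IsProbabilityMeasure ρ] [ErgodicVAdd ℝ (X × Y) ρ]
    {E : Set (X × Y)} (hE : MeasurableSet E) (hE0 : 0 < ρ E)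
    (hEc : ∀ y, {x | (x, y) ∈ E}.Countable) : FiniteToOneAE (Prod.snd : X × Y → Y) ρ := by
  have hne : Nonempty X := (nonempty_of_isProbabilityMeasure ρ).map Prod.fst
  set θ : Measure (Y × X) := ρ.map Prod.swap
  have hθ : IsProbabilityMeasure θ := Measure.isProbabilityMeasure_map measurable_swap.aemeasurable
  set κ := θ.condKernel
  have hdis : θ = θ.fst.compProd κ := (θ.disintegrate κ).symm
  have hflow : ∀ t : ℝ, MeasurePreserving (fun p : Y × X => (t +ᵥ p.1, t +ᵥ p.2)) θ θ := by
    intro t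
    have hm : Measurable fun p : Y × X => (t +ᵥ p.1, t +ᵥ p.2) :=
      (measurable_fst.const_vadd t).prodMk (measurable_snd.const_vadd t)
    refine ⟨hm, ?_⟩
    have h1 := (measurePreserving_vadd t ρ).map_eq
    conv_rhs => rw [show θ = ρ.map Prod.swap from rfl, ← h1]
    rw [Measure.map_map hm measurable_swap,
      Measure.map_map measurable_swap (measurable_const_vadd t)]
    rfl
  have hν : ∀ t : ℝ, MeasurePreserving (fun y : Y => t +ᵥ y) θ.fst θ.fst := by
    intro t
    have hm : Measurable fun y : Y => t +ᵥ y := measurable_const_vadd t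
    refine ⟨hm, ?_⟩
    conv_rhs => rw [Measure.fst, ← (hflow t).map_eq]
    rw [Measure.fst, Measure.map_map hm measurable_fst,
      Measure.map_map measurable_fst (hflow t).measurable]
    rfl
  have hequi : ∀ t : ℝ, ∀ᵐ y ∂θ.fst, ∀ x, κ (t +ᵥ y) {t +ᵥ x} = κ y {x} := by
    intro t
    -- The conditional measures transported by the flow also disintegrate θ; uniqueness of the
    -- disintegration gives equivariance.
    let κt : ProbabilityTheory.Kernel Y X := (κ.comap (t +ᵥ ·) (hν t).measurable).map (-t +ᵥ ·)
    have hmt : Measurable fun x : X => -t +ᵥ x := measurable_const_vadd (-t)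
    have hfin : ProbabilityTheory.IsMarkovKernel κt := ProbabilityTheory.Kernel.IsMarkovKernel.map _ hmt
    have heq : θ = θ.fst.compProd κt := by
      ext s hs
      have hs' := (hflow (-t)).measurable hs
      rw [Measure.compProd_apply hs, ← (hflow (-t)).measure_preimage hs.nullMeasurableSet]
      conv_lhs => rw [hdis]
      rw [Measure.compProd_apply hs', ← (hν t).lintegral_comp
        (ProbabilityTheory.Kernel.measurable_kernel_prodMk_left hs')]
      refine lintegral_congr fun y => ?_
      rw [ProbabilityTheory.Kernel.map_apply' _ hmt _ (measurable_prodMk_left hs),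
        ProbabilityTheory.Kernel.comap_apply]
      congr 1
      ext x; simp
    filter_upwards [ProbabilityTheory.eq_condKernel_of_measure_eq_compProd κt heq] with y hy x
    rw [← hy, ProbabilityTheory.Kernel.map_apply' _ hmt _ (measurableSet_singleton x),
      ProbabilityTheory.Kernel.comap_apply]
    congr 1
    ext w
    simp only [mem_singleton_iff, mem_preimage]
    rw [neg_vadd_eq_iff]
  let φ : X × Y → ENNReal := fun z => κ z.2 {z.1}
  have hφ : Measurable φ := by
    have h1 : MeasurableSet {p : (X × Y) × X | p.2 = p.1.1} :=
      measurableSet_eq_fun measurable_snd (measurable_fst.comp measurable_fst)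
    exact ProbabilityTheory.Kernel.measurable_kernel_prodMk_left
      (κ := κ.comap Prod.snd measurable_snd) h1
  have hsnd : θ.fst = ρ.map Prod.snd := by
    rw [Measure.fst, Measure.map_map measurable_fst measurable_swap]; rfl
  have hinv : ∀ t : ℝ, ∀ᵐ z ∂ρ, φ (t +ᵥ z) = φ z := by
    intro t
    have := hequi t
    rw [hsnd] at this
    filter_upwards [ae_of_ae_map measurable_snd.aemeasurable this] with z hz
    exact hz z.1
  obtain ⟨c, hc⟩ : ∃ c, φ =ᵐ[ρ] Function.const _ c := by
    refine exists_eventuallyEq_const_of_forall_separating MeasurableSet fun U hU => ?_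
    refine eventuallyConst_set.1 (aeconst_of_forall_preimage_vadd_ae_eq ℝ
      (hφ hU).nullMeasurableSet fun t => eventuallyEq_set.2 ?_)
    filter_upwards [hinv t] with z hz
    change φ (t +ᵥ z) ∈ U ↔ φ z ∈ U
    rw [hz]
  -- If almost every point had conditional mass zero, the countable fibres of E would be null and E
  -- would have measure zero.
  have hc0 : c ≠ 0 := by
    rintro rfl
    refine hE0.ne' ?_
    have h1 : ρ {z | z ∈ E ∧ φ z = 0} = ρ E := measure_congr (eventuallyEq_set.2 (by
      filter_upwards [hc] with z hz
      exact ⟨fun h => h.1, fun h => ⟨h, hz⟩⟩))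
    have hm : MeasurableSet {z | z ∈ E ∧ φ z = 0} := hE.inter (hφ (measurableSet_singleton 0))
    have h2 : ρ {z | z ∈ E ∧ φ z = 0} = θ (Prod.swap ⁻¹' {z | z ∈ E ∧ φ z = 0}) := by
      rw [Measure.map_apply measurable_swap (measurable_swap hm)]; rfl
    rw [← h1, h2, hdis, Measure.compProd_apply (measurable_swap hm), lintegral_eq_zero_iff
      (ProbabilityTheory.Kernel.measurable_kernel_prodMk_left (measurable_swap hm))]
    refine .of_forall fun y => ?_
    have hcount : (Prod.mk y ⁻¹' (Prod.swap ⁻¹' {z | z ∈ E ∧ φ z = 0})).Countable :=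
      (hEc y).mono fun x hx => hx.1
    change κ y _ = 0
    rw [← biUnion_of_singleton (Prod.mk y ⁻¹' (Prod.swap ⁻¹' {z | z ∈ E ∧ φ z = 0})),
      measure_biUnion_null_iff hcount]
    exact fun x hx => hx.2
  refine ⟨φ ⁻¹' {c}, hφ (measurableSet_singleton c), mem_ae_iff.1 hc, fun y => ?_⟩
  have hfin : {x : X | c ≤ κ y {x}}.Finite :=
    Measure.finite_const_le_meas_of_disjoint_iUnion (κ y) (pos_iff_ne_zero.2 hc0)
      (fun x => measurableSet_singleton x)
      (fun x x' hxx => by simpa [Function.onFun] using hxx) (measure_ne_top _ _)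
  refine (hfin.image fun x => (x, y)).subset ?_
  rintro ⟨x, y'⟩ ⟨hx, hy⟩
  obtain rfl : y' = y := hy
  exact ⟨x, (mem_singleton_iff.1 hx).ge, rfl⟩

end Fibres

/-! ### Factors, and assembly of the two statements. -/

/-- A factor of an ergodic flow is ergodic. -/
lemma IsFactorMap.ergodicVAdd {X Y : Type*} [MeasurableSpace X] [MeasurableSpace Y] [AddAction ℝ X]
    [AddAction ℝ Y] [MeasurableVAdd₂ ℝ Y] {μ : Measure X} {ν : Measure Y}
    [ErgodicVAdd ℝ X μ] {ψ : X → Y} (h : IsFactorMap ψ μ ν) : ErgodicVAdd ℝ Y ν where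
  measure_preimage_vadd c s hs := by
    have hψ := h.measurePreserving
    rw [← hψ.measure_preimage hs.nullMeasurableSet, ← hψ.measure_preimage
      (measurable_const_vadd c hs).nullMeasurableSet,
      ← VAddInvariantMeasure.measure_preimage_vadd (μ := μ) c (hψ.measurable hs)]
    refine measure_congr (eventuallyEq_set.2 ?_)
    filter_upwards [h.equivariant c] with x hx
    change c +ᵥ ψ x ∈ s ↔ ψ (c +ᵥ x) ∈ s
    rw [hx]
  aeconst_of_forall_preimage_vadd_ae_eq {s} hs hinv := by
    have hψ := h.measurePreserving
    have hconst : EventuallyConst (ψ ⁻¹' s) (ae μ) := by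
      refine aeconst_of_forall_preimage_vadd_ae_eq ℝ (hψ.measurable hs).nullMeasurableSet
        fun t => eventuallyEq_set.2 ?_
      filter_upwards [h.equivariant t,
        hψ.quasiMeasurePreserving.ae (eventuallyEq_set.1 (hinv t))] with x hx hx'
      change ψ (t +ᵥ x) ∈ s ↔ ψ x ∈ s
      rw [hx]
      exact hx'
    rw [eventuallyConst_set] at hconst ⊢
    rw [← hψ.map_eq]
    exact hconst.imp (fun h => (ae_map_iff hψ.measurable.aemeasurable hs).2 h)
      fun h => (ae_map_iff hψ.measurable.aemeasurable hs.compl).2 h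

lemma ergodicVAdd_of_ergodic {X : Type*} [MeasurableSpace X] [AddAction ℝ X] {μ : Measure X}
    [VAddInvariantMeasure ℝ X μ] {s : ℝ} (h : Ergodic (fun x : X => s +ᵥ x) μ) :
    ErgodicVAdd ℝ X μ where
  aeconst_of_forall_preimage_vadd_ae_eq hA hinv :=
    h.quasiErgodic.aeconst_set₀ hA.nullMeasurableSet (hinv s)

/-- Points of a separable space at mutual distance at least `δ` form a countable set. -/
lemma countable_of_le_dist {X : Type*} [MetricSpace X] [SecondCountableTopology X] {S : Set X}
    {δ : ℝ} (hδ : 0 < δ) (h : ∀ x ∈ S, ∀ x' ∈ S, x ≠ x' → δ ≤ dist x x') : S.Countable := by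
  refine Set.PairwiseDisjoint.countable_of_isOpen (s := fun x => Metric.ball x (δ / 2)) ?_
    (fun x _ => Metric.isOpen_ball) (fun x _ => Metric.nonempty_ball.2 (half_pos hδ))
  intro x hx x' hx' hxx
  exact Metric.ball_disjoint_ball (by linarith [h x hx x' hx' hxx])

/-- An ergodic joining of a weakly mixing flow with the weak Ratner property is either the product
or a finite extension of the second flow. -/
theorem eq_prod_or_isFiniteExtension {X Y : Type*} [MetricSpace X] [SigmaCompactSpace X]
    [MeasurableSpace X] [BorelSpace X] {μ : Measure X} [IsProbabilityMeasure μ] [AddAction ℝ X]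
    [MeasurableVAdd₂ ℝ X] [VAddInvariantMeasure ℝ X μ] (hmix : WeaklyMixing μ) {P : Set ℝ}
    (hP : IsCompact P) (hP0 : (0 : ℝ) ∉ P) (hR : WeakRatner μ P) (hcont : AlmostContinuous μ)
    [MeasurableSpace Y] [StandardBorelSpace Y] {ν : Measure Y} [IsProbabilityMeasure ν]
    [AddAction ℝ Y] [MeasurableVAdd₂ ℝ Y] {ρ : Measure (X × Y)} (hρ : IsErgodicJoining μ ν ρ) :
    ρ = μ.prod ν ∨ IsFiniteExtension (Prod.snd : X × Y → Y) ρ ν := by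
  have : StandardBorelSpace X := standardBorelSpace_of_sigmaCompact X
  have : SecondCountableTopology X := EMetric.secondCountable_of_sigmaCompact X
  have : IsProbabilityMeasure ρ := ⟨by
    rw [← preimage_univ (f := Prod.snd), ← Measure.map_apply measurable_snd .univ, hρ.map_snd,
      measure_univ]⟩
  have := hρ.ergodic
  by_cases hprod : ρ = μ.prod ν
  · exact Or.inl hprod
  right
  refine ⟨⟨⟨measurable_snd, hρ.map_snd⟩, fun t => .of_forall fun z => rfl⟩, ?_⟩
  have hne : ∀ q : ℝ, q ≠ 0 → ρ.map (fun z => (q +ᵥ z.1, z.2)) ≠ ρ := fun q hq heq =>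
    hprod (eq_prod_of_map_eq hρ.map_fst hρ.map_snd (ergodic_of_weaklyMixing hmix hq) heq)
  -- Otherwise the uncountable set of Ratner times would lie in the countable set of non-ergodic
  -- nonzero times of the joining.
  obtain ⟨t₀, ht₀, herg⟩ : ∃ t₀, RatnerAt μ t₀ P ∧ Ergodic (fun z : X × Y => t₀ +ᵥ z) ρ := by
    by_contra! h
    refine hR (Set.Countable.mono (fun s hs => ?_) (countable_not_ergodic (ρ := ρ)))
    have hs' : RatnerAt μ s P := hs
    exact ⟨hs'.1, h s hs'⟩
  obtain ⟨E, hE, hE0, δ, hδ, hsep⟩ :=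
    exists_separated_set hρ.map_fst hcont hne hP hP0 ht₀ herg
  exact finiteToOneAE_of_countable_fibres hE hE0 fun y =>
    countable_of_le_dist hδ fun x hx x' hx' hxx => hsep x x' y hx hx' hxx

/-- Nontrivial factors of a weakly mixing flow with the weak Ratner property are finite. -/
theorem IsFactorMap.isFiniteExtension {X Y : Type*} [MetricSpace X] [SigmaCompactSpace X]
    [MeasurableSpace X] [BorelSpace X] {μ : Measure X} [IsProbabilityMeasure μ] [AddAction ℝ X]
    [MeasurableVAdd₂ ℝ X] [VAddInvariantMeasure ℝ X μ] (hmix : WeaklyMixing μ) {P : Set ℝ}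
    (hP : IsCompact P) (hP0 : (0 : ℝ) ∉ P) (hR : WeakRatner μ P) (hcont : AlmostContinuous μ)
    [MeasurableSpace Y] [StandardBorelSpace Y] {ν : Measure Y} [IsProbabilityMeasure ν]
    [AddAction ℝ Y] [MeasurableVAdd₂ ℝ Y] {ψ : X → Y} (hψ : IsFactorMap ψ μ ν) (hν : Nontriv ν) :
    IsFiniteExtension ψ μ ν := by
  have : StandardBorelSpace X := standardBorelSpace_of_sigmaCompact X
  have : ErgodicVAdd ℝ X μ := ergodicVAdd_of_ergodic (ergodic_of_weaklyMixing hmix one_ne_zero)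
  have hm := hψ.measurePreserving.measurable
  -- The graph map exhibits the graph joining as a factor of the ergodic flow on X, so the joining
  -- is ergodic.
  let γ : X → X × Y := fun x => (x, ψ x)
  have hγ : Measurable γ := measurable_id.prodMk hm
  have hγf : IsFactorMap γ μ (μ.map γ) := ⟨⟨hγ, rfl⟩, fun t => by
    filter_upwards [hψ.equivariant t] with x hx
    exact Prod.ext rfl hx⟩
  have hjoin : IsErgodicJoining μ ν (μ.map γ) :=
    ⟨by rw [Measure.map_map measurable_fst hγ]; exact Measure.map_id,
      by rw [Measure.map_map measurable_snd hγ]; exact hψ.measurePreserving.map_eq,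
      hγf.ergodicVAdd⟩
  refine ⟨hψ, ?_⟩
  rcases eq_prod_or_isFiniteExtension hmix hP hP0 hR hcont hjoin with hprod | ⟨-, E, hE, hE0, hfin⟩
  · exfalso
    obtain ⟨A, hA, hA0, hA1⟩ := hν
    have h1 : μ (ψ ⁻¹' A) = ν A := hψ.measurePreserving.measure_preimage hA.nullMeasurableSet
    -- On this rectangle the graph joining has mass ν(A) and the product ν(A)², which differ for 0 <
    -- ν(A) < 1.
    have h2 := congrArg (fun m : Measure (X × Y) => m ((ψ ⁻¹' A) ×ˢ A)) hprod
    have h3 : γ ⁻¹' ((ψ ⁻¹' A) ×ˢ A) = ψ ⁻¹' A := by ext x; simp [γ]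
    simp only [Measure.map_apply hγ ((hm hA).prod hA), Measure.prod_prod, h3, h1] at h2
    exact hA1.ne ((ENNReal.mul_eq_left hA0.ne' (measure_ne_top _ _)).1 h2.symm)
  · refine ⟨γ ⁻¹' E, hγ hE, ?_, fun y => ?_⟩
    · rwa [Measure.map_apply hγ hE.compl] at hE0
    · refine Set.Finite.of_finite_image ((hfin y).subset ?_) (f := γ)
        fun x _ x' _ h => congrArg Prod.fst h
      rintro _ ⟨x, ⟨hx, hxy⟩, rfl⟩
      exact ⟨hx, hxy⟩

end RatnerFlow

theorem theorem5p9 {X : Type*} [MetricSpace X] [SigmaCompactSpace X] [MeasurableSpace X]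
    [BorelSpace X] (μ : Measure X) [IsProbabilityMeasure μ]
    [AddAction ℝ X] [MeasurableVAdd₂ ℝ X] [VAddInvariantMeasure ℝ X μ]
    (hmix : RatnerFlow.WeaklyMixing μ)
    (P : Set ℝ) (hPne : P.Nonempty) (hPcpt : IsCompact P) (hP0 : (0 : ℝ) ∉ P)
    (hR : RatnerFlow.WeakRatner μ P) (hcont : RatnerFlow.AlmostContinuous μ) :
    (∀ (Y : Type*) [MeasurableSpace Y] [StandardBorelSpace Y] (ν : Measure Y)
        [IsProbabilityMeasure ν] [AddAction ℝ Y] [MeasurableVAdd₂ ℝ Y] [ErgodicVAdd ℝ Y ν]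
        (ρ : Measure (X × Y)), RatnerFlow.IsErgodicJoining μ ν ρ →
        ρ = μ.prod ν ∨ RatnerFlow.IsFiniteExtension (Prod.snd : X × Y → Y) ρ ν) ∧
    (∀ (X' : Type*) [MeasurableSpace X'] [StandardBorelSpace X'] (μ' : Measure X')
        [IsProbabilityMeasure μ'] [AddAction ℝ X'] [MeasurableVAdd₂ ℝ X']
        [VAddInvariantMeasure ℝ X' μ'] (ψ : X → X'),
        RatnerFlow.IsFactorMap ψ μ μ' → RatnerFlow.Nontriv μ' →
        RatnerFlow.IsFiniteExtension ψ μ μ') := by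
  refine ⟨?_, ?_⟩
  · intro Y _ _ ν _ _ _ _ ρ hρ
    exact RatnerFlow.eq_prod_or_isFiniteExtension hmix hPcpt hP0 hR hcont hρ
  · intro X' _ _ μ' _ _ _ _ ψ hψ hν
    exact RatnerFlow.IsFactorMap.isFiniteExtension hmix hPcpt hP0 hR hcont hψ hν
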